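/- **Setting.** Fix a binary floating point format as in IEEE 754, with $p\ge 1$ significant bits and exponents between $e_{\min}\le 0$ and $e_{\max}\ge 0$. Let $\mathbb F$ be its set of finite floating point numbers (subnormal numbers included) and let $\mathrm u=2^{-p}$ be its unit roundoff. A real number is *within the exponent range* if it is $0$ or if its modulus lies between $2^{e_{\min}}$ and the largest element of $\mathbb F$. Each basic operation ($+,-,\times,/,\sqrt{\ }$) whose exact result is in $\mathbb F$ or within the exponent range returns a floating point number nearest to that exact result (ties are broken by an arbitrary rule); nothing is assumed about the other results. Inner products, matrix-vector products and norms are evaluated with these operations, summing from the first to the last term. Let $\|\cdot\|$ be the Euclidean vector norm and the spectral matrix norm, $\kappa(A)=\|A\|\,\|A^{-1}\|$, and let $e_1$ be the first column of an identity matrix. Let $$A=PTP^{T}\in\mathbb R^{n\times n},\qquad b=\widetilde\beta_1Pe_1\in\mathbb R^n,$$ where $P$ is a signed permutation matrix (a permutation matrix with nonzero entries $\pm1$ instead of $1$) and $T$ is the symmetric tridiagonal matrix with diagonal $\widetilde\alpha_1,\dots,\widetilde\alpha_n\in\mathbb F$ and off-diagonal $\widetilde\beta_2,\dots,\widetilde\beta_n$,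 where $\widetilde\beta_j\in\mathbb F$, $\widetilde\beta_j>0$ and $\widetilde\beta_j^2$ is within the exponent range for $j=1,\dots,n$. Assume that $A$ is positive definite, and let $1\le k\le n$. *Lanczos algorithm in floating point arithmetic.* Put $\beta_1=\|b\|$, $v_0=0$, $v_1=b/\beta_1$, and for $i=1,2,\dots$ compute $w=Av_i-\beta_iv_{i-1}$, $\alpha_i=w^Tv_i$, $z=w-\alpha_iv_i$, $\beta_{i+1}=\|z\|$ and, if $\beta_{i+1}\neq0$, $v_{i+1}=z/\beta_{i+1}$ (otherwise stop). Let $V_k=[v_1,\dots,v_k]$, and let $T_k$ be the symmetric tridiagonal matrix with diagonal $\alpha_1,\dots,\alpha_k$ and off-diagonal $\beta_2,\dots,\beta_k$, where all these quantities are the computed ones. *$LDL^T$ solution in floating point arithmetic.* The system $T_ky=\|b\|e_1$, with the computed value $\beta_1$ of $\|b\|$, is solved numerically as follows: $d_1=\alpha_1$, and $\ell_j=\beta_{j+1}/d_j$, $d_{j+1}=\alpha_{j+1}-\beta_{j+1}\ell_j$ for $j=1,\dots,k-1$; forward substitution $z_1=\beta_1$, $z_{j+1}=0-\ell_jz_j$;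 $w_j=z_j/d_j$; back substitution $\eta_k=w_k$, $\eta_j=w_j-\ell_j\eta_{j+1}$ for $j=k-1,\dots,1$. Let $\bar y_k=(\eta_1,\dots,\eta_k)^T$ be the computed solution, and assume that the exact result of each operation of this solution is within the exponent range (no overflow or underflow). Let $\bar x_k=V_k\bar y_k$, evaluated in floating point arithmetic, and let $x_k$ be the $k$-th approximation produced in exact arithmetic by the (Hestenes–Stiefel) conjugate gradient method applied to $Ax=b$ with $x_0=0$. **Theorem.** If $5\mathrm u\,\kappa(A)<1$, then the computed $\beta_1,\dots,\beta_k$ and pivots $d_1,\dots,d_k$ are nonzero (so neither algorithm breaks down), $x_k\neq0$, the product $\bar x_k=V_k\bar y_k$ is evaluated without rounding errors, and $$\frac{\|x_k-\bar x_k\|}{\|x_k\|}\le\frac{5\mathrm u\,\kappa(A)}{1-5\mathrm u\,\kappa(A)} .$$ -/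

import Mathlib

/-! Indices are shifted by one with respect to the usual mathematical notation: for every sequence
below (`α`, `β`, `d`, `ℓ`, `v`, `z`, `w`, `y`) the entry with Lean index `j` is the entry with
mathematical index `j + 1`. -/

noncomputable section

/-! ### Binary floating point arithmetic -/

/-- A binary floating point format as in IEEE 754: `p` significant bits and normalized numbers with
exponents between `emin` and `emax`. -/
structure BinaryFormat where
  p : ℕ
  emin : ℤ
  emax : ℤ
  one_le_p : 1 ≤ p
  emin_nonpos : emin ≤ 0
  emax_nonneg : 0 ≤ emax

namespace BinaryFormat

/-- The (finite) floating point numbers of the format, subnormal numbers included. -/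
def IsFloat (F : BinaryFormat) (x : ℝ) : Prop :=
  ∃ m e : ℤ, |m| < 2 ^ F.p ∧ F.emin - F.p + 1 ≤ e ∧ e ≤ F.emax - F.p + 1 ∧
    x = (m : ℝ) * (2 : ℝ) ^ e

/-- The largest floating point number. -/
def maxFloat (F : BinaryFormat) : ℝ :=
  ((2 : ℝ) ^ F.p - 1) * (2 : ℝ) ^ (F.emax - F.p + 1)

/-- `x` is within the exponent range: neither overflow nor underflow. -/
def InRange (F : BinaryFormat) (x : ℝ) : Prop :=
  x = 0 ∨ ((2 : ℝ) ^ F.emin ≤ |x| ∧ |x| ≤ F.maxFloat)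

/-- The unit roundoff `u = 2⁻ᵖ` (half of the machine epsilon). -/
def unitRoundoff (F : BinaryFormat) : ℝ := ((2 : ℝ) ^ F.p)⁻¹

/-- `rd` rounds to a nearest floating point number, with an arbitrary rule for ties. Nothing is
required of the result when overflow or (inexact) underflow occurs. The floating point result of a
basic operation `a ∘ b` is `rd (a ∘ b)`. -/
def IsRoundToNearest (F : BinaryFormat) (rd : ℝ → ℝ) : Prop :=
  ∀ x : ℝ, F.IsFloat x ∨ F.InRange x →
    F.IsFloat (rd x) ∧ ∀ y : ℝ, F.IsFloat y → |rd x - x| ≤ |y - x|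

end BinaryFormat

/-! ### Vector operations in floating point arithmetic -/

/-- Inner product `xᵀy`: every product and every addition is rounded, summing from first to last. -/
def flDot (rd : ℝ → ℝ) {n : ℕ} (x y : Fin n → ℝ) : ℝ :=
  Fin.foldl n (fun s i => rd (s + rd (x i * y i))) 0

def flMulVec (rd : ℝ → ℝ) {m n : ℕ} (A : Matrix (Fin m) (Fin n) ℝ) (x : Fin n → ℝ) : Fin m → ℝ :=
  fun i => flDot rd (A i) x

def flNorm (rd : ℝ → ℝ) {n : ℕ} (x : Fin n → ℝ) : ℝ :=
  rd (Real.sqrt (flDot rd x x))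

/-! ### Structured input data -/

/-- The symmetric tridiagonal `n × n` matrix with diagonal `α 0, …, α (n-1)` and off-diagonal
`β 1, …, β (n-1)`. -/
def tridiag (n : ℕ) (α β : ℕ → ℝ) : Matrix (Fin n) (Fin n) ℝ :=
  Matrix.of fun i j =>
    if (i : ℕ) = j then α i
    else if (i : ℕ) + 1 = j then β j
    else if (j : ℕ) + 1 = i then β i
    else 0

/-- A permutation matrix with nonzero entries `±1` instead of `1`. -/
def IsSignedPermutation {n : ℕ} (P : Matrix (Fin n) (Fin n) ℝ) : Prop :=
  ∃ (σ : Equiv.Perm (Fin n)) (s : Fin n → ℝ), (∀ j, s j = 1 ∨ s j = -1) ∧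
    ∀ i j, P i j = if i = σ j then s j else 0

/-- The first column `e₁` of the identity matrix. -/
def firstUnitVec (n : ℕ) : Fin n → ℝ := fun i => if (i : ℕ) = 0 then 1 else 0

/-- The spectral condition number `κ(A) = ‖A‖₂ ‖A⁻¹‖₂`. -/
def condNumber {n : ℕ} (A : Matrix (Fin n) (Fin n) ℝ) : ℝ :=
  ‖Matrix.toEuclideanCLM (n := Fin n) (𝕜 := ℝ) A‖ *
    ‖Matrix.toEuclideanCLM (n := Fin n) (𝕜 := ℝ) A⁻¹‖

/-! ### The Lanczos algorithm in floating point arithmetic -/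

/-- The data `β_i`, `v_{i-1}`, `v_i` at the start of a pass of the Lanczos loop. -/
structure LanczosState (n : ℕ) where
  β : ℝ
  vPrev : Fin n → ℝ
  v : Fin n → ℝ

section Lanczos

variable (rd : ℝ → ℝ) {n : ℕ} (A : Matrix (Fin n) (Fin n) ℝ)

/-- `β₁ = ‖b‖`, `v₀ = 0`, `v₁ = b / β₁`. -/
def lanczosInit (b : Fin n → ℝ) : LanczosState n where
  β := flNorm rd b
  vPrev := 0
  v := fun i => rd (b i / flNorm rd b)

/-- `w = A v_i - β_i v_{i-1}`. -/
def lanczosW (s : LanczosState n) : Fin n → ℝ :=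
  fun i => rd (flMulVec rd A s.v i - rd (s.β * s.vPrev i))

/-- `α_i = wᵀ v_i`. -/
def lanczosCoeff (s : LanczosState n) : ℝ :=
  flDot rd (lanczosW rd A s) s.v

/-- `z = w - α_i v_i`. -/
def lanczosZ (s : LanczosState n) : Fin n → ℝ :=
  fun i => rd (lanczosW rd A s i - rd (lanczosCoeff rd A s * s.v i))

/-- `β_{i+1} = ‖z‖`, `v_{i+1} = z / β_{i+1}`. -/
def lanczosStep (s : LanczosState n) : LanczosState n where
  β := flNorm rd (lanczosZ rd A s)
  vPrev := s.v
  v := fun i => rd (lanczosZ rd A s i / flNorm rd (lanczosZ rd A s))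

/-- The states of the algorithm; they are meaningful as long as the computed `β` are nonzero (the
algorithm stops when one of them is zero). -/
def lanczosState (b : Fin n → ℝ) : ℕ → LanczosState n
  | 0 => lanczosInit rd b
  | j + 1 => lanczosStep rd A (lanczosState b j)

/-- The computed diagonal coefficients. -/
def lanczosAlpha (b : Fin n → ℝ) (j : ℕ) : ℝ := lanczosCoeff rd A (lanczosState rd A b j)

/-- The computed off-diagonal coefficients; `lanczosBeta rd A b 0` is the computed norm of `b`. -/
def lanczosBeta (b : Fin n → ℝ) (j : ℕ) : ℝ := (lanczosState rd A b j).β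

/-- The computed matrix `V_k = [v₁, …, v_k]` of Lanczos vectors. -/
def lanczosV (b : Fin n → ℝ) (k : ℕ) : Matrix (Fin n) (Fin k) ℝ :=
  Matrix.of fun i j => (lanczosState rd A b j).v i

end Lanczos

/-! ### Solving a symmetric tridiagonal system by `LDLᵀ` in floating point arithmetic

The system has the matrix `tridiag k α β` and the right-hand side `c e₁`. -/

section LDL

variable (rd : ℝ → ℝ) (α β : ℕ → ℝ) (c : ℝ)

/-- Pivots: `d₁ = α₁`, `d_{j+1} = α_{j+1} - β_{j+1} ℓ_j` with `ℓ_j = β_{j+1} / d_j`. -/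
def ldlD : ℕ → ℝ
  | 0 => α 0
  | j + 1 => rd (α (j + 1) - rd (β (j + 1) * rd (β (j + 1) / ldlD j)))

/-- Multipliers `ℓ_j = β_{j+1} / d_j`. -/
def ldlL (j : ℕ) : ℝ := rd (β (j + 1) / ldlD rd α β j)

/-- Forward substitution for `L z = c e₁`. -/
def ldlZ : ℕ → ℝ
  | 0 => c
  | j + 1 => rd (0 - rd (ldlL rd α β j * ldlZ j))

/-- Solution of the diagonal system `D w = z`. -/
def ldlW (j : ℕ) : ℝ := rd (ldlZ rd α β c j / ldlD rd α β j)

/-- Back substitution for `Lᵀ y = w`: the component `y_j`, where `m` is the number of components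
below it. -/
def ldlBack : ℕ → ℕ → ℝ
  | 0, j => ldlW rd α β c j
  | m + 1, j => rd (ldlW rd α β c j - rd (ldlL rd α β j * ldlBack m (j + 1)))

/-- The computed solution of the system of size `k`, as a sequence (used for indices `j < k`). -/
def ldlY (k j : ℕ) : ℝ := ldlBack rd α β c (k - 1 - j) j

/-- No operation of the `LDLᵀ` solution of the system of size `k` overflows or underflows: its exact
result is within the exponent range. -/
structure LDLSolveInRange (F : BinaryFormat) (k : ℕ) : Prop where
  mult : ∀ j, j + 1 < k → F.InRange (β (j + 1) / ldlD rd α β j)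
  pivot_mul : ∀ j, j + 1 < k → F.InRange (β (j + 1) * ldlL rd α β j)
  pivot_sub : ∀ j, j + 1 < k → F.InRange (α (j + 1) - rd (β (j + 1) * ldlL rd α β j))
  forward_mul : ∀ j, j + 1 < k → F.InRange (ldlL rd α β j * ldlZ rd α β c j)
  diag_div : ∀ j, j < k → F.InRange (ldlZ rd α β c j / ldlD rd α β j)
  back_mul : ∀ j, j + 1 < k → F.InRange (ldlL rd α β j * ldlY rd α β c k (j + 1))
  back_sub : ∀ j, j + 1 < k →
    F.InRange (ldlW rd α β c j - rd (ldlL rd α β j * ldlY rd α β c k (j + 1)))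

end LDL

/-- The computed solution `ȳ_k` of `T_k y = ‖b‖ e₁`, where `T_k` and `‖b‖` are the computed ones. -/
def computedY (rd : ℝ → ℝ) {n : ℕ} (A : Matrix (Fin n) (Fin n) ℝ) (b : Fin n → ℝ) (k : ℕ) :
    Fin k → ℝ :=
  fun j => ldlY rd (lanczosAlpha rd A b) (lanczosBeta rd A b) (lanczosBeta rd A b 0) k j

/-- The computed approximate solution `x̄_k = V_k ȳ_k`, the product being evaluated in floating
point arithmetic too. -/
def computedX (rd : ℝ → ℝ) {n : ℕ} (A : Matrix (Fin n) (Fin n) ℝ) (b : Fin n → ℝ) (k : ℕ) :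
    Fin n → ℝ :=
  flMulVec rd (lanczosV rd A b k) (computedY rd A b k)

/-! ### The conjugate gradient method in exact arithmetic -/

structure CGState (n : ℕ) where
  x : Fin n → ℝ
  r : Fin n → ℝ
  p : Fin n → ℝ

section CG

open Matrix

variable {n : ℕ} (A : Matrix (Fin n) (Fin n) ℝ)

/-- One pass of the Hestenes–Stiefel loop. -/
def cgStep (s : CGState n) : CGState n :=
  let γ : ℝ := (s.r ⬝ᵥ s.r) / (s.p ⬝ᵥ (A *ᵥ s.p))
  let r' : Fin n → ℝ := s.r - γ • (A *ᵥ s.p)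
  let δ : ℝ := (r' ⬝ᵥ r') / (s.r ⬝ᵥ s.r)
  { x := s.x + γ • s.p
    r := r'
    p := r' + δ • s.p }

def cgState (b x₀ : Fin n → ℝ) : ℕ → CGState n
  | 0 => { x := x₀, r := b - A *ᵥ x₀, p := b - A *ᵥ x₀ }
  | k + 1 => cgStep A (cgState b x₀ k)

/-- The exact CG approximation `x_k`. -/
def cgX (b x₀ : Fin n → ℝ) (k : ℕ) : Fin n → ℝ := (cgState A b x₀ k).x

end CG

end

/-! The data are chosen so that Lanczos commits no error. Each exact Lanczos vector is a signed unit
vector, so every sum has at most one nonzero term and every product or quotient returns an input up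
to sign. The exception is the norm, where `x ^ 2` is really rounded; in binary arithmetic the
rounded square root recovers `x` (`sqrt_sq`). Hence the computed coefficients are those of the
tridiagonal matrix `T`, and the computed `V_k` consists of columns of `P` (`lanczosState_isExact`).
Multiplying by such a `V_k` is again exact, so the only errors come from the `LDLᵀ` solution.

CG commutes with `P`. Applied to `T` and a multiple of `e₁`, its iterate `x` is supported on the
first `k` entries and its residual vanishes there (`cgState_isKrylov`), so `x` solves the exact
leading system.

For the computed solution `y`, extended by zero, the residual satisfies `|T (x - y)| ≤ 5u T|y|` in
the first `k` rows (`residual_zero`, `residual_succ`). No absolute value is needed on `T`, since its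
entries are nonnegative. A diagonal entry splits as pivot plus `q`, where `q` is the rounded product
subtracted in elimination and collects five rounding factors. The constant `5` survives second-order
terms only because the pivot is at least `4uΛ`, with `Λ = ‖A‖`; `pivot_lower_bound` and
`scaled_form_lower_bound` derive this from the assumption on `κ`.

With `e = x - y` and `μ = ‖A⁻¹‖`, the energy estimate `‖e‖² ≤ μ e·Te ≤ 5u μ |e|·T|y| ≤ 5u μ Λ ‖e‖
‖y‖` gives an error bound relative to `‖y‖` (`ldlSol_error`). The triangle inequality makes it
relative to `‖x‖`. -/

/-! ### Rounding to nearest in a binary format. -/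

namespace BinaryFormat

variable {F : BinaryFormat} {rd : ℝ → ℝ}

theorem IsFloat.neg {x : ℝ} (h : F.IsFloat x) : F.IsFloat (-x) := by
  obtain ⟨m, e, hm, h1, h2, rfl⟩ := h
  exact ⟨-m, e, by rwa [abs_neg], h1, h2, by push_cast; ring⟩

theorem isFloat_zero : F.IsFloat 0 := by
  refine ⟨0, F.emin - F.p + 1, by simp, le_rfl, ?_, by simp⟩
  have := F.emin_nonpos
  have := F.emax_nonneg
  omega

theorem isFloat_two_zpow {g : ℤ} (h1 : F.emin ≤ g) (h2 : g ≤ F.emax) :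
    F.IsFloat ((2 : ℝ) ^ g) := by
  have hp := F.one_le_p
  refine ⟨2 ^ (F.p - 1), g - F.p + 1, ?_, by omega, by omega, ?_⟩
  · rw [abs_of_nonneg (by positivity)]
    exact pow_lt_pow_right₀ (by norm_num) (by omega)
  · push_cast
    rw [← zpow_natCast, ← zpow_add₀ (by norm_num)]
    congr 1
    push_cast [hp]
    ring

theorem isFloat_one : F.IsFloat 1 := by
  simpa using isFloat_two_zpow (F := F) (g := 0) F.emin_nonpos F.emax_nonneg

theorem maxFloat_lt : F.maxFloat < (2 : ℝ) ^ (F.emax + 1) := by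
  have h : (2 : ℝ) ^ (F.emax + 1) = 2 ^ F.p * (2 : ℝ) ^ (F.emax - F.p + 1) := by
    rw [← zpow_natCast, ← zpow_add₀ (by norm_num)]
    congr 1
    ring
  rw [maxFloat, h]
  have : (0 : ℝ) < (2 : ℝ) ^ (F.emax - F.p + 1) := by positivity
  nlinarith

theorem one_le_maxFloat : 1 ≤ F.maxFloat := by
  have hp := F.one_le_p
  have h1 : (2 : ℝ) ^ F.p = 2 * 2 ^ (F.p - 1) := by
    rw [← pow_succ']
    congr 1
    omega
  have h2 : (1 : ℝ) ≤ 2 ^ (F.p - 1) := one_le_pow₀ (by norm_num)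
  have h3 : (2 : ℝ) ^ F.emax = 2 ^ (F.p - 1) * (2 : ℝ) ^ (F.emax - F.p + 1) := by
    rw [← zpow_natCast, ← zpow_add₀ (by norm_num)]
    congr 1
    push_cast [hp]
    ring
  have h4 : (1 : ℝ) ≤ (2 : ℝ) ^ F.emax := one_le_zpow₀ (by norm_num) F.emax_nonneg
  have h5 : (0 : ℝ) < (2 : ℝ) ^ (F.emax - F.p + 1) := by positivity
  rw [maxFloat]
  nlinarith

theorem IsFloat.abs_le_maxFloat {x : ℝ} (h : F.IsFloat x) : |x| ≤ F.maxFloat := by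
  obtain ⟨m, e, hm, h1, h2, rfl⟩ := h
  have hm' : |(m : ℝ)| ≤ 2 ^ F.p - 1 := by
    have : |m| ≤ 2 ^ F.p - 1 := by omega
    exact_mod_cast this
  rw [abs_mul, abs_of_pos (a := (2 : ℝ) ^ e) (by positivity), maxFloat]
  have : (2 : ℝ) ^ e ≤ (2 : ℝ) ^ (F.emax - F.p + 1) := zpow_le_zpow_right₀ (by norm_num) h2
  have h0 := abs_nonneg (m : ℝ)
  gcongr
  linarith

theorem unitRoundoff_pos : 0 < F.unitRoundoff := by
  unfold unitRoundoff
  positivity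

theorem InRange.neg {x : ℝ} (h : F.InRange x) : F.InRange (-x) := by
  simpa [InRange] using h

/-- Tie-breaking is arbitrary, so `rd` need not be odd; reflecting the whole rounding function still
reduces negative arguments to positive ones. -/
theorem IsRoundToNearest.neg (hrd : F.IsRoundToNearest rd) :
    F.IsRoundToNearest (fun x => -rd (-x)) := by
  intro x hx
  obtain ⟨h1, h2⟩ := hrd (-x) (hx.imp IsFloat.neg InRange.neg)
  refine ⟨h1.neg, fun y hy => ?_⟩
  have := h2 (-y) hy.neg
  rw [← abs_neg, ← abs_neg (y - x)]
  convert this using 2 <;> ring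

theorem IsRoundToNearest.eq_self (hrd : F.IsRoundToNearest rd) {x : ℝ} (hx : F.IsFloat x) :
    rd x = x := by
  have := (hrd x (Or.inl hx)).2 x hx
  simpa [sub_eq_zero] using this

theorem IsRoundToNearest.map_zero (hrd : F.IsRoundToNearest rd) : rd 0 = 0 :=
  hrd.eq_self isFloat_zero

/-- A positive number in the exponent range lies in a binade of the format. -/
theorem InRange.exists_exponent {x : ℝ} (hx : F.InRange x) (h0 : 0 < x) :
    ∃ g : ℤ, F.emin ≤ g ∧ g ≤ F.emax ∧ (2 : ℝ) ^ g ≤ x ∧ x < (2 : ℝ) ^ (g + 1) := by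
  obtain h | ⟨h1, h2⟩ := hx
  · exact absurd h h0.ne'
  rw [abs_of_pos h0] at h1 h2
  obtain ⟨g, hg1, hg2⟩ := exists_mem_Ico_zpow h0 (one_lt_two (α := ℝ))
  refine ⟨g, ?_, ?_, hg1, hg2⟩
  · have := (zpow_lt_zpow_iff_right₀ (one_lt_two (α := ℝ))).1 (h1.trans_lt hg2)
    omega
  · have := (zpow_lt_zpow_iff_right₀ (one_lt_two (α := ℝ))).1
      (hg1.trans_lt (h2.trans_lt maxFloat_lt))
    omega

/-- Every number in a binade is within half a unit in the last place of some float. -/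
theorem exists_isFloat_near {x : ℝ} (hx : x ≤ F.maxFloat) {g : ℤ} (h1 : F.emin ≤ g)
    (h2 : g ≤ F.emax) (h3 : (2 : ℝ) ^ g ≤ x) (h4 : x < (2 : ℝ) ^ (g + 1)) :
    ∃ y, F.IsFloat y ∧ |y - x| ≤ (2 : ℝ) ^ (g - F.p + 1) / 2 := by
  set e : ℤ := g - F.p + 1 with he
  have hE : (0 : ℝ) < (2 : ℝ) ^ e := by positivity
  have hG : (2 : ℝ) ^ (g + 1) = 2 ^ F.p * (2 : ℝ) ^ e := by
    rw [← zpow_natCast, ← zpow_add₀ (by norm_num)]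
    congr 1
    omega
  have hx0 : 0 < x := lt_of_lt_of_le (by positivity) h3
  set t := x / (2 : ℝ) ^ e with ht
  have hxt : x = t * (2 : ℝ) ^ e := by rw [ht]; field_simp
  have ht0 : 0 < t := by positivity
  have ht1 : t < 2 ^ F.p := by rw [ht, div_lt_iff₀ hE, ← hG]; exact h4
  have hr := abs_sub_round t
  have hm0 : 0 ≤ round t := by
    rw [round_eq]
    exact Int.floor_nonneg.2 (by linarith)
  have hm1 : round t ≤ 2 ^ F.p := by
    rw [round_eq]
    have : ⌊t + 1 / 2⌋ < 2 ^ F.p + 1 := by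
      rw [Int.floor_lt]
      push_cast
      linarith
    omega
  have hclose : |(round t : ℝ) * (2 : ℝ) ^ e - x| ≤ (2 : ℝ) ^ e / 2 := by
    rw [hxt, ← sub_mul, abs_mul, abs_of_pos hE, abs_sub_comm]
    nlinarith
  refine ⟨_, ?_, hclose⟩
  -- Rounding up to `2 ^ p` carries into the next binade. In the top binade this cannot happen: `x ≤
  -- maxFloat` means `t ≤ 2 ^ p - 1`.
  rcases hm1.lt_or_eq with hlt | heq
  · exact ⟨round t, e, by rwa [abs_of_nonneg hm0], by omega, by omega, rfl⟩
  · rcases h2.lt_or_eq with hg | hg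
    · rw [heq]
      push_cast
      rw [← hG]
      exact isFloat_two_zpow (by omega) (by omega)
    · exfalso
      have : t ≤ 2 ^ F.p - 1 := by
        rw [ht, div_le_iff₀ hE, he, hg]
        exact hx
      have h5 : ((round t : ℤ) : ℝ) = 2 ^ F.p := by rw [heq]; push_cast; rfl
      rw [h5, abs_le] at hr
      linarith [hr.1]

theorem IsRoundToNearest.error_bounds_of_pos (hrd : F.IsRoundToNearest rd) {x : ℝ}
    (hx : F.InRange x) (h0 : 0 < x) :
    |rd x - x| ≤ F.unitRoundoff * |rd x| ∧
      (1 + F.unitRoundoff) * |rd x - x| ≤ F.unitRoundoff * |x| := by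
  obtain ⟨g, h1, h2, h3, h4⟩ := hx.exists_exponent h0
  obtain ⟨-, hn⟩ := hrd x (Or.inr hx)
  have hmax : x ≤ F.maxFloat := by
    obtain h | h := hx
    · exact absurd h h0.ne'
    · exact (le_abs_self x).trans h.2
  obtain ⟨y, hy, hyx⟩ := exists_isFloat_near hmax h1 h2 h3 h4
  have ha := (hn y hy).trans hyx
  -- Comparison with the float `2 ^ g` yields both `|rd x| ≥ 2 ^ g` and `x ≥ 2 ^ g + |rd x - x|`;
  -- the latter is the source of the constant `u / (1 + u)`.
  have hb := hn _ (isFloat_two_zpow h1 h2)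
  rw [abs_sub_comm ((2 : ℝ) ^ g), abs_of_nonneg (sub_nonneg.2 h3)] at hb
  have hG : (2 : ℝ) ^ g = 2 ^ F.p * ((2 : ℝ) ^ (g - F.p + 1) / 2) := by
    rw [← zpow_natCast, zpow_add₀ (by norm_num), zpow_sub₀ (by norm_num)]
    simp
    field_simp
  set h := (2 : ℝ) ^ (g - F.p + 1) / 2
  have hN : (0 : ℝ) < 2 ^ F.p := by positivity
  have hlow : 2 ^ F.p * h ≤ |rd x| := by
    have := abs_sub_abs_le_abs_sub x (rd x)
    rw [abs_sub_comm x, abs_of_pos h0] at this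
    linarith
  have hmul := mul_le_mul_of_nonneg_left ha hN.le
  unfold unitRoundoff
  constructor
  · rw [inv_mul_eq_div, le_div_iff₀ hN]
    linarith
  · rw [inv_mul_eq_div, le_div_iff₀ hN, abs_of_pos h0]
    field_simp
    linarith

/-- Both forms of the standard model of floating point arithmetic, the second one with the optimal
constant `u / (1 + u)`. -/
theorem IsRoundToNearest.error_bounds (hrd : F.IsRoundToNearest rd) {x : ℝ} (hx : F.InRange x) :
    |rd x - x| ≤ F.unitRoundoff * |rd x| ∧
      (1 + F.unitRoundoff) * |rd x - x| ≤ F.unitRoundoff * |x| := by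
  rcases lt_trichotomy x 0 with h | rfl | h
  · have := hrd.neg.error_bounds_of_pos hx.neg (neg_pos.2 h)
    simp only [neg_neg, abs_neg] at this
    rw [← abs_neg (rd x - x)]
    convert this using 4 <;> ring
  · simp [hrd.map_zero]
  · exact hrd.error_bounds_of_pos hx h

theorem IsRoundToNearest.isFloat (hrd : F.IsRoundToNearest rd) {x : ℝ} (hx : F.InRange x) :
    F.IsFloat (rd x) :=
  (hrd x (Or.inr hx)).1

theorem IsFloat.exists_multiple {z : ℝ} (h : F.IsFloat z) {g : ℤ} (hz : (2 : ℝ) ^ g < |z|) :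
    ∃ m : ℤ, z = m * (2 : ℝ) ^ (g - F.p + 1) := by
  obtain ⟨m, e, hm, -, -, rfl⟩ := h
  have : g < F.p + e := by
    rw [← zpow_lt_zpow_iff_right₀ (one_lt_two (α := ℝ)), zpow_add₀ (by norm_num), zpow_natCast]
    refine hz.trans_le ?_
    rw [abs_mul, abs_of_pos (a := (2 : ℝ) ^ e) (by positivity)]
    gcongr
    exact_mod_cast hm.le
  obtain ⟨c, hc⟩ := Int.eq_ofNat_of_zero_le (a := e - (g - F.p + 1)) (by omega)
  refine ⟨m * 2 ^ c, ?_⟩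
  push_cast
  rw [mul_assoc, ← zpow_natCast, ← zpow_add₀ (by norm_num)]
  congr 2
  omega

/-- A float above `2 ^ g` is at distance at least `2 ^ (g - p + 1)` from every other float. -/
theorem IsFloat.spacing {x y : ℝ} (hx : F.IsFloat x) (hy : F.IsFloat y) {g : ℤ}
    (h1 : (2 : ℝ) ^ g < x) (hne : y ≠ x) : (2 : ℝ) ^ (g - F.p + 1) ≤ |y - x| := by
  have hx0 : 0 < x := lt_trans (by positivity) h1
  obtain ⟨m, hm⟩ := hx.exists_multiple (by rwa [abs_of_pos hx0])
  have hgm : (2 : ℝ) ^ g = ((2 ^ (F.p - 1) : ℤ) : ℝ) * (2 : ℝ) ^ (g - F.p + 1) := by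
    have hp := F.one_le_p
    push_cast
    rw [← zpow_natCast, ← zpow_add₀ (by norm_num)]
    congr 1
    push_cast [hp]
    omega
  have hE : (0 : ℝ) < (2 : ℝ) ^ (g - F.p + 1) := by positivity
  rcases lt_or_ge ((2 : ℝ) ^ g) |y| with hlt | hge
  · obtain ⟨m', hm'⟩ := hy.exists_multiple hlt
    have hmm : m' - m ≠ 0 := by
      rintro h
      exact hne (by rw [hm, hm', sub_eq_zero.1 h])
    have h2 : (1 : ℝ) ≤ |(m' : ℝ) - m| := by exact_mod_cast Int.one_le_abs hmm
    rw [hm, hm', ← sub_mul, abs_mul, abs_of_pos hE]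
    nlinarith
  · have hml : (2 ^ (F.p - 1) : ℤ) < m := by
      rw [hm, hgm] at h1
      exact_mod_cast lt_of_mul_lt_mul_right h1 hE.le
    have : (((2 ^ (F.p - 1) : ℤ) : ℝ) + 1) ≤ m := by exact_mod_cast hml
    have h5 : (2 : ℝ) ^ (g - F.p + 1) + (2 : ℝ) ^ g ≤ x := by
      have := mul_le_mul_of_nonneg_right this hE.le
      rw [← hm, add_mul, ← hgm] at this
      linarith
    rw [abs_sub_comm]
    have := le_abs_self (x - y)
    have := le_abs_self y
    linarith

/-- The square root of a rounded square rounds back. -/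
theorem IsRoundToNearest.sqrt_sq (hrd : F.IsRoundToNearest rd) {x : ℝ} (hx : F.IsFloat x)
    (h0 : 0 < x) (hr : F.InRange (x ^ 2)) : rd (Real.sqrt (rd (x ^ 2))) = x := by
  obtain ⟨g, hg1, hg2⟩ := exists_mem_Ico_zpow h0 (one_lt_two (α := ℝ))
  have hr' := hr
  obtain h | ⟨hlo, hhi⟩ := hr'
  · exact absurd h (by positivity)
  rw [abs_of_pos (by positivity)] at hlo hhi
  -- A power of two has an exact square. It is treated apart because floats are denser just below
  -- it, so `spacing` would fail.
  rcases hg1.eq_or_lt with heq | hlt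
  · have hsq : x ^ 2 = (2 : ℝ) ^ (g + g) := by
      rw [zpow_add₀ (by norm_num), heq, sq]
    have : F.IsFloat (x ^ 2) := by
      rw [hsq] at hlo hhi ⊢
      refine isFloat_two_zpow ((zpow_le_zpow_iff_right₀ (one_lt_two (α := ℝ))).1 hlo) ?_
      have := (zpow_lt_zpow_iff_right₀ (one_lt_two (α := ℝ))).1 (hhi.trans_lt maxFloat_lt)
      omega
    rw [hrd.eq_self this, Real.sqrt_sq h0.le, hrd.eq_self hx]
  set u := F.unitRoundoff with hu
  set y := rd (x ^ 2) with hy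
  have hu0 : 0 < u := unitRoundoff_pos
  have hu1 : u ≤ 1 / 2 := by
    rw [hu, unitRoundoff, one_div]
    refine inv_anti₀ (by norm_num) ?_
    simpa using pow_le_pow_right₀ (one_le_two (α := ℝ)) F.one_le_p
  obtain ⟨hyf, hyn⟩ := hrd (x ^ 2) (Or.inr hr)
  have hylo : (2 : ℝ) ^ F.emin ≤ y := by
    have h1 := hyn _ (isFloat_two_zpow le_rfl (F.emin_nonpos.trans F.emax_nonneg))
    rw [abs_sub_comm ((2 : ℝ) ^ F.emin), abs_of_nonneg (sub_nonneg.2 hlo)] at h1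
    have := neg_abs_le (rd (x ^ 2) - x ^ 2)
    linarith
  have hy0 : 0 < y := lt_of_lt_of_le (by positivity) hylo
  have herr : |y - x ^ 2| ≤ u * x ^ 2 := by
    have h1 := (hrd.error_bounds hr).2
    rw [abs_of_pos (a := x ^ 2) (by positivity)] at h1
    nlinarith [abs_nonneg (rd (x ^ 2) - x ^ 2)]
  set r := Real.sqrt y with hr_def
  have hr0 : 0 < r := Real.sqrt_pos.2 hy0
  have hrr : r ^ 2 = y := Real.sq_sqrt hy0.le
  have hrange : F.InRange r := by
    right
    rw [abs_of_pos hr0]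
    have hm1 := one_le_maxFloat (F := F)
    have hm2 : (2 : ℝ) ^ F.emin ≤ 1 := zpow_le_one_of_nonpos₀ (by norm_num) F.emin_nonpos
    have hm3 : y ≤ F.maxFloat := (le_abs_self y).trans hyf.abs_le_maxFloat
    have hm4 : (0 : ℝ) < (2 : ℝ) ^ F.emin := by positivity
    constructor
    · refine Real.le_sqrt_of_sq_le ?_
      nlinarith
    · refine Real.sqrt_le_iff.2 ⟨by linarith, ?_⟩
      nlinarith
  set ε := (2 : ℝ) ^ (g - F.p + 1) with hε
  have hε0 : 0 < ε := by positivity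
  -- The significand of `x` is an integer, hence at most `2 ^ p - 1`. This strict gap below the next
  -- binade is what puts `r` within `ε / 2` of `x`.
  have hxε : x * u ≤ ε * (1 - u) := by
    obtain ⟨m, hm⟩ := hx.exists_multiple (g := g) (by rwa [abs_of_pos h0])
    have hG : (2 : ℝ) ^ (g + 1) = 2 ^ F.p * ε := by
      rw [hε, ← zpow_natCast, ← zpow_add₀ (by norm_num)]
      congr 1
      omega
    have hm1 : m < 2 ^ F.p := by
      rw [hm, hG] at hg2
      exact_mod_cast lt_of_mul_lt_mul_right hg2 hε0.le
    have hm2 : (m : ℝ) ≤ 2 ^ F.p - 1 := by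
      have : m ≤ 2 ^ F.p - 1 := by omega
      exact_mod_cast this
    have hN : (0 : ℝ) < 2 ^ F.p := by positivity
    have : (m : ℝ) * u ≤ 1 - u := by
      rw [hu, unitRoundoff]
      field_simp
      exact hm2
    calc x * u = m * u * ε := by rw [hm]; ring
      _ ≤ (1 - u) * ε := by gcongr
      _ = ε * (1 - u) := mul_comm _ _
  -- Otherwise `|r² - x²| ≤ u x²` forces `r ≤ x (1 - 2u)`, and then `1 - u ≤ (1 - 2u)²`, impossible
  -- for `0 < u ≤ 1/2`.
  have hclose : |r - x| < ε / 2 := by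
    by_contra! hcon
    have e1 : |r - x| * (r + x) ≤ u * x ^ 2 := by
      rw [← abs_of_pos (a := r + x) (by positivity), ← abs_mul]
      have : (r - x) * (r + x) = y - x ^ 2 := by
        rw [← hrr]
        ring
      rwa [this]
    have e2 : ε / 2 * (r + x) ≤ x * (ε * (1 - u)) := by
      refine (mul_le_mul_of_nonneg_right hcon (by positivity)).trans (e1.trans ?_)
      calc u * x ^ 2 = x * (x * u) := by ring
        _ ≤ x * (ε * (1 - u)) := by gcongr
    have e3 : r ≤ x * (1 - 2 * u) := by
      have : ε * (r + x) ≤ ε * (2 * x * (1 - u)) := by linarith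
      linarith [le_of_mul_le_mul_left this hε0]
    have e4 : y ≤ x ^ 2 * (1 - 2 * u) ^ 2 := by
      rw [← hrr, ← mul_pow]
      gcongr
    have e5 : x ^ 2 * (1 - u) ≤ y := by linarith [(abs_le.1 herr).1]
    have e6 : (1 - u) ≤ (1 - 2 * u) ^ 2 :=
      le_of_mul_le_mul_left (e5.trans e4) (by positivity)
    nlinarith
  -- Another float would be at distance at least `ε` from `x`, whereas `rd r` and `x` are both
  -- closer than `ε / 2` to `r`.
  by_contra hne
  have h1 := hx.spacing (hrd.isFloat hrange) hlt hne
  have h2 := (hrd r (Or.inr hrange)).2 x hx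
  have h3 := abs_sub_le (rd r) r x
  rw [abs_sub_comm x r] at h2
  linarith

end BinaryFormat

/-! ### Inner products with at most one nonzero term. -/

section Dot

variable {rd : ℝ → ℝ} {n : ℕ}

theorem flDot_succ (x y : Fin (n + 1) → ℝ) :
    flDot rd x y = rd (flDot rd (fun i : Fin n => x i.castSucc) (fun i => y i.castSucc) +
      rd (x (Fin.last n) * y (Fin.last n))) := by
  rw [flDot, Fin.foldl_succ_last]
  rfl

theorem flDot_eq_zero (h0 : rd 0 = 0) {x y : Fin n → ℝ} (h : ∀ i, x i * y i = 0) :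
    flDot rd x y = 0 := by
  induction n with
  | zero => simp [flDot]
  | succ n ih =>
    rw [flDot_succ, ih fun i => h _, h, h0, add_zero, h0]

/-- An inner product with at most one nonzero term involves a single rounding. -/
theorem flDot_eq_single (h0 : rd 0 = 0) {x y : Fin n → ℝ} (i₀ : Fin n)
    (h : ∀ i, i ≠ i₀ → x i * y i = 0) (hid : rd (rd (x i₀ * y i₀)) = rd (x i₀ * y i₀)) :
    flDot rd x y = rd (x i₀ * y i₀) := by
  induction n with
  | zero => exact i₀.elim0
  | succ n ih =>
    rw [flDot_succ]
    rcases Fin.eq_castSucc_or_eq_last i₀ with ⟨j, rfl⟩ | rfl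
    · rw [ih j (fun i hi => h _ (by simpa using hi)) hid, h _ (Fin.castSucc_lt_last j).ne', h0,
        add_zero, hid]
    · rw [flDot_eq_zero h0 fun i => h _ (Fin.castSucc_lt_last i).ne, zero_add, hid]

end Dot

/-! ### Exactness of the Lanczos process on the structured problem. -/

section LanczosExact

variable {F : BinaryFormat} {rd : ℝ → ℝ} {n : ℕ} {A : Matrix (Fin n) (Fin n) ℝ} {b : Fin n → ℝ}
  {α β : ℕ → ℝ} {σ : Equiv.Perm (Fin n)} {s : Fin n → ℝ}

theorem sign_mul_isFloat {t x : ℝ} (ht : t = 1 ∨ t = -1) (hx : F.IsFloat x) :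
    F.IsFloat (t * x) := by
  rcases ht with rfl | rfl
  · simpa using hx
  · simpa using hx.neg

theorem sq_eq_one_of_sign {t : ℝ} (ht : t = 1 ∨ t = -1) : t * t = 1 := by
  rcases ht with rfl | rfl <;> norm_num

/-- The computed norm of a vector with a single nonzero entry is exact. -/
theorem flNorm_eq_single (hrd : F.IsRoundToNearest rd) {x : Fin n → ℝ} (i₀ : Fin n) {t c : ℝ}
    (ht : t = 1 ∨ t = -1) (hc : F.IsFloat c) (hc0 : 0 < c) (hcr : F.InRange (c ^ 2))
    (h : ∀ i, i ≠ i₀ → x i = 0) (hx : x i₀ = t * c) : flNorm rd x = c := by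
  have hsq : x i₀ * x i₀ = c ^ 2 := by
    rw [hx, mul_mul_mul_comm, sq_eq_one_of_sign ht]
    ring
  rw [flNorm, flDot_eq_single hrd.map_zero i₀ (fun i hi => by rw [h i hi, zero_mul]), hsq,
    hrd.sqrt_sq hc hc0 hcr]
  rw [hsq]
  exact hrd.eq_self (hrd.isFloat hcr)

theorem tridiag_isFloat (hα : ∀ j, j < n → F.IsFloat (α j)) (hβ : ∀ j, j < n → F.IsFloat (β j))
    (i j : Fin n) : F.IsFloat (tridiag n α β i j) := by
  simp only [tridiag, Matrix.of_apply]
  split_ifs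
  · exact hα _ i.2
  · exact hβ _ j.2
  · exact hβ _ i.2
  · exact BinaryFormat.isFloat_zero

/-- The state of the Lanczos algorithm when the `j`th Lanczos vector is exact. -/
structure LanczosState.IsExact (σ : Equiv.Perm (Fin n)) (s : Fin n → ℝ) (β : ℕ → ℝ) (j : ℕ)
    (S : LanczosState n) : Prop where
  β_eq : S.β = β j
  v_eq : ∀ i, S.v (σ i) = if (i : ℕ) = j then s i else 0
  vPrev_eq : ∀ i, S.vPrev (σ i) = if (i : ℕ) + 1 = j then s i else 0

theorem rd_sign_div (hrd : F.IsRoundToNearest rd) {t c : ℝ} (ht : t = 1 ∨ t = -1) (hc : 0 < c) :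
    rd (t * c / c) = t := by
  rw [mul_div_cancel_right₀ _ hc.ne']
  have := sign_mul_isFloat ht (BinaryFormat.isFloat_one (F := F))
  rw [mul_one] at this
  exact hrd.eq_self this

variable (hrd : F.IsRoundToNearest rd) (hα : ∀ j, j < n → F.IsFloat (α j))
  (hβ : ∀ j, j < n → F.IsFloat (β j) ∧ 0 < β j ∧ F.InRange (β j ^ 2))
  (hs : ∀ j, s j = 1 ∨ s j = -1)

include hrd hβ hs in
theorem lanczosInit_isExact (hn : 0 < n)
    (hb : ∀ i, b (σ i) = if (i : ℕ) = 0 then s i * β 0 else 0) :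
    (lanczosInit rd b).IsExact σ s β 0 := by
  obtain ⟨h1, h2, h3⟩ := hβ 0 hn
  have hnorm : flNorm rd b = β 0 := by
    refine flNorm_eq_single hrd (σ ⟨0, hn⟩) (hs ⟨0, hn⟩) h1 h2 h3 (fun i hi => ?_) (by simp [hb])
    obtain ⟨i, rfl⟩ := σ.surjective i
    rw [hb, if_neg]
    rintro h
    exact hi (by congr 1; exact Fin.ext h)
  refine ⟨hnorm, fun i => ?_, fun i => ?_⟩
  · simp only [lanczosInit, hnorm, hb]
    split_ifs
    · exact rd_sign_div hrd (hs i) h2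
    · rw [zero_div, hrd.map_zero]
  · simp [lanczosInit]

variable (hA : ∀ i j, A (σ i) (σ j) = s i * s j * tridiag n α β i j)

section Step

variable {S : LanczosState n} {j : ℕ} (hj : j < n) (hS : S.IsExact σ s β j)

include hrd hα hβ hs hA hj hS

theorem flMulVec_isExact (i : Fin n) :
    flMulVec rd A S.v (σ i) = s i * tridiag n α β i ⟨j, hj⟩ := by
  have hval : A (σ i) (σ ⟨j, hj⟩) * S.v (σ ⟨j, hj⟩) = s i * tridiag n α β i ⟨j, hj⟩ := by
    rw [hA, hS.v_eq, if_pos rfl]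
    linear_combination (s i * tridiag n α β i ⟨j, hj⟩) * sq_eq_one_of_sign (hs ⟨j, hj⟩)
  have hfl := hrd.eq_self (sign_mul_isFloat (hs i)
    (tridiag_isFloat hα (fun j hj => (hβ j hj).1) i ⟨j, hj⟩))
  rw [flMulVec, flDot_eq_single hrd.map_zero (σ ⟨j, hj⟩), hval, hfl]
  · intro l hl
    obtain ⟨l, rfl⟩ := σ.surjective l
    rw [hS.v_eq, if_neg, mul_zero]
    rintro h
    exact hl (by congr 1; exact Fin.ext h)
  · rw [hval, hfl, hfl]

/-- Column `j` of `T` has at most three nonzero entries; the one above the diagonal is cancelled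
exactly by `β_j v_{j-1}`. -/
theorem lanczosW_isExact (i : Fin n) :
    lanczosW rd A S (σ i) =
      if (i : ℕ) = j then s i * α j else if (i : ℕ) = j + 1 then s i * β (j + 1) else 0 := by
  rw [lanczosW, flMulVec_isExact hrd hα hβ hs hA hj hS, hS.vPrev_eq, hS.β_eq]
  have hval : s i * tridiag n α β i ⟨j, hj⟩ - rd (β j * if (i : ℕ) + 1 = j then s i else 0) =
      if (i : ℕ) = j then s i * α j else if (i : ℕ) = j + 1 then s i * β (j + 1) else 0 := by
    simp only [tridiag, Matrix.of_apply]
    by_cases h1 : (i : ℕ) = j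
    · simp [h1, hrd.map_zero]
    by_cases h2 : (i : ℕ) + 1 = j
    · have h3 : (i : ℕ) ≠ j + 1 := by omega
      rw [if_neg h1, if_pos h2, if_pos h2, if_neg h1, if_neg h3, mul_comm (β j),
        hrd.eq_self (sign_mul_isFloat (hs i) (hβ j hj).1), sub_self]
    by_cases h3 : (i : ℕ) = j + 1
    · have h4 : j + 1 + 1 ≠ j := by omega
      simp [h3, h4, hrd.map_zero]
    · simp [h1, h2, h3, hrd.map_zero, Ne.symm h3]
  rw [hval]
  split_ifs with h1 h2
  · exact hrd.eq_self (sign_mul_isFloat (hs i) (hα j hj))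
  · exact hrd.eq_self (sign_mul_isFloat (hs i) (hβ _ (h2 ▸ i.2)).1)
  · exact hrd.map_zero

theorem lanczosCoeff_isExact : lanczosCoeff rd A S = α j := by
  have hval : lanczosW rd A S (σ ⟨j, hj⟩) * S.v (σ ⟨j, hj⟩) = α j := by
    rw [lanczosW_isExact hrd hα hβ hs hA hj hS, hS.v_eq, if_pos rfl, if_pos rfl]
    linear_combination α j * sq_eq_one_of_sign (hs ⟨j, hj⟩)
  rw [lanczosCoeff, flDot_eq_single hrd.map_zero (σ ⟨j, hj⟩), hval, hrd.eq_self (hα j hj)]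
  · intro l hl
    obtain ⟨l, rfl⟩ := σ.surjective l
    rw [hS.v_eq, if_neg, mul_zero]
    rintro h
    exact hl (by congr 1; exact Fin.ext h)
  · rw [hval, hrd.eq_self (hα j hj), hrd.eq_self (hα j hj)]

theorem lanczosZ_isExact (i : Fin n) :
    lanczosZ rd A S (σ i) = if (i : ℕ) = j + 1 then s i * β (j + 1) else 0 := by
  rw [lanczosZ, lanczosW_isExact hrd hα hβ hs hA hj hS, lanczosCoeff_isExact hrd hα hβ hs hA hj hS,
    hS.v_eq]
  split_ifs with h1 h2 h2
  · omega
  · rw [mul_comm (α j), hrd.eq_self (sign_mul_isFloat (hs i) (hα j hj)), sub_self, hrd.map_zero]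
  · rw [mul_zero, hrd.map_zero, sub_zero]
    exact hrd.eq_self (sign_mul_isFloat (hs i) (hβ _ (h2 ▸ i.2)).1)
  · rw [mul_zero, hrd.map_zero, sub_zero, hrd.map_zero]

theorem lanczosStep_isExact (hj1 : j + 1 < n) : (lanczosStep rd A S).IsExact σ s β (j + 1) := by
  obtain ⟨h1, h2, h3⟩ := hβ _ hj1
  have hz := lanczosZ_isExact hrd hα hβ hs hA hj hS
  have hnorm : flNorm rd (lanczosZ rd A S) = β (j + 1) := by
    refine flNorm_eq_single hrd (σ ⟨j + 1, hj1⟩) (hs ⟨j + 1, hj1⟩) h1 h2 h3 (fun i hi => ?_)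
      (by simp [hz])
    obtain ⟨i, rfl⟩ := σ.surjective i
    rw [hz, if_neg]
    rintro h
    exact hi (by congr 1; exact Fin.ext h)
  refine ⟨hnorm, fun i => ?_, fun i => ?_⟩
  · simp only [lanczosStep, hnorm, hz]
    split_ifs
    · exact rd_sign_div hrd (hs i) h2
    · rw [zero_div, hrd.map_zero]
  · simpa [lanczosStep] using hS.v_eq i

end Step

include hrd hα hβ hs hA

/-- On the structured problem the Lanczos algorithm commits no rounding errors. -/
theorem lanczosState_isExact (hb : ∀ i, b (σ i) = if (i : ℕ) = 0 then s i * β 0 else 0) {j : ℕ}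
    (hj : j < n) : (lanczosState rd A b j).IsExact σ s β j := by
  induction j with
  | zero => exact lanczosInit_isExact hrd hβ hs hj hb
  | succ j ih => exact lanczosStep_isExact hrd hα hβ hs hA (by omega) (ih (by omega)) hj

theorem lanczosAlpha_eq (hb : ∀ i, b (σ i) = if (i : ℕ) = 0 then s i * β 0 else 0) {j : ℕ}
    (hj : j < n) : lanczosAlpha rd A b j = α j :=
  lanczosCoeff_isExact hrd hα hβ hs hA hj (lanczosState_isExact hrd hα hβ hs hA hb hj)

theorem lanczosBeta_eq (hb : ∀ i, b (σ i) = if (i : ℕ) = 0 then s i * β 0 else 0) {j : ℕ}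
    (hj : j < n) : lanczosBeta rd A b j = β j :=
  (lanczosState_isExact hrd hα hβ hs hA hb hj).β_eq

theorem lanczosV_apply (hb : ∀ i, b (σ i) = if (i : ℕ) = 0 then s i * β 0 else 0) {k : ℕ}
    (hk : k ≤ n) (i : Fin n) (j : Fin k) :
    lanczosV rd A b k (σ i) j = if (i : ℕ) = j then s i else 0 :=
  (lanczosState_isExact hrd hα hβ hs hA hb (j.2.trans_le hk)).v_eq i

/-- The product of the computed Lanczos vectors with a vector of floats is exact. -/
theorem flMulVec_lanczosV (hb : ∀ i, b (σ i) = if (i : ℕ) = 0 then s i * β 0 else 0) {k : ℕ}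
    (hk : k ≤ n) {y : Fin k → ℝ} (hy : ∀ j, F.IsFloat (y j)) (i : Fin n) :
    flMulVec rd (lanczosV rd A b k) y (σ i) =
      s i * (if h : (i : ℕ) < k then y ⟨i, h⟩ else 0) := by
  have hV := lanczosV_apply hrd hα hβ hs hA hb hk i
  rw [flMulVec]
  split_ifs with h
  · have hfl := hrd.eq_self (sign_mul_isFloat (hs i) (hy ⟨i, h⟩))
    have hval : lanczosV rd A b k (σ i) ⟨i, h⟩ = s i := by simp [hV]
    rw [flDot_eq_single hrd.map_zero ⟨i, h⟩, hval, hfl]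
    · intro l hl
      rw [hV, if_neg, zero_mul]
      exact fun h' => hl (Fin.ext h'.symm)
    · rw [hval, hfl, hfl]
  · rw [flDot_eq_zero hrd.map_zero, mul_zero]
    intro l
    rw [hV, if_neg, zero_mul]
    omega

theorem lanczosV_mulVec (hb : ∀ i, b (σ i) = if (i : ℕ) = 0 then s i * β 0 else 0) {k : ℕ}
    (hk : k ≤ n) (y : Fin k → ℝ) (i : Fin n) :
    (lanczosV rd A b k).mulVec y (σ i) =
      s i * (if h : (i : ℕ) < k then y ⟨i, h⟩ else 0) := by
  simp only [Matrix.mulVec, dotProduct, lanczosV_apply hrd hα hβ hs hA hb hk]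
  split_ifs with h
  · rw [Finset.sum_eq_single ⟨i, h⟩]
    · simp
    · intro l _ hl
      rw [if_neg, zero_mul]
      exact fun h' => hl (Fin.ext h'.symm)
    · simp
  · rw [mul_zero]
    refine Finset.sum_eq_zero fun l _ => ?_
    rw [if_neg, zero_mul]
    omega

end LanczosExact

open Matrix

/-! ### Tridiagonal products and quadratic forms on sequences. -/

section Tridiagonal

variable {n : ℕ} {α β : ℕ → ℝ}

/-- The `i`th component of the product of an infinite tridiagonal matrix with `g`. -/
def triRow (α β g : ℕ → ℝ) (i : ℕ) : ℝ :=
  (if i = 0 then 0 else β i * g (i - 1)) + α i * g i + β (i + 1) * g (i + 1)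

theorem triRow_zero (g : ℕ → ℝ) : triRow α β g 0 = α 0 * g 0 + β 1 * g 1 := by
  simp [triRow]

theorem triRow_succ (g : ℕ → ℝ) (i : ℕ) :
    triRow α β g (i + 1) = β (i + 1) * g i + α (i + 1) * g (i + 1) + β (i + 2) * g (i + 2) := by
  simp [triRow]

theorem tridiag_mulVec (g : ℕ → ℝ) (hg : ∀ i, n ≤ i → g i = 0) (i : Fin n) :
    (tridiag n α β *ᵥ fun j : Fin n => g j) i = triRow α β g i := by
  let f : ℕ → ℝ := fun l => (if l = i then α i * g i else 0) +
    (if l = i + 1 then β l * g l else 0) + (if l + 1 = i then β i * g l else 0)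
  have hterm : ∀ j : Fin n, tridiag n α β i j * g j = f j := by
    intro j
    simp only [tridiag, of_apply, f]
    by_cases h1 : (i : ℕ) = j
    · have h2 : (j : ℕ) ≠ i + 1 := by omega
      have h3 : (j : ℕ) + 1 ≠ i := by omega
      rw [if_pos h1, if_pos h1.symm, if_neg h2, if_neg h3, h1]
      ring
    · simp only [if_neg h1, if_neg (Ne.symm h1), eq_comm (a := (j : ℕ)) (b := (i : ℕ) + 1)]
      by_cases h2 : (i : ℕ) + 1 = j
      · have h3 : (j : ℕ) + 1 ≠ i := by omega
        simp [h2, h3]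
      · simp [h2]
  have hin : (i : ℕ) < n := i.2
  simp only [mulVec, dotProduct]
  rw [Finset.sum_congr rfl fun j _ => hterm j, Fin.sum_univ_eq_sum_range f n, Finset.sum_add_distrib,
    Finset.sum_add_distrib, Finset.sum_ite_eq' _ _ (fun _ => α i * g i),
    Finset.sum_ite_eq' _ _ (fun l => β l * g l), if_pos (Finset.mem_range.2 hin), triRow]
  have h1 : (if (i : ℕ) + 1 ∈ Finset.range n then β (i + 1) * g (i + 1) else 0) =
      β (i + 1) * g (i + 1) := by
    split_ifs with h
    · rfl
    · rw [hg _ (by simpa using h), mul_zero]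
  rw [h1]
  rcases Nat.eq_zero_or_pos (i : ℕ) with h | h
  · simp [h]
  · obtain ⟨m, hm⟩ := Nat.exists_eq_succ_of_ne_zero h.ne'
    have : ∀ l : ℕ, (l + 1 = i) = (l = m) := by intro l; simp [hm]
    simp only [this, Finset.sum_ite_eq']
    rw [if_pos (Finset.mem_range.2 (by omega)), if_neg h.ne', hm]
    simp only [Nat.succ_eq_add_one, Nat.add_sub_cancel]
    ring

/-- Extension of a vector by zero. -/
def extendZero (x : Fin n → ℝ) (i : ℕ) : ℝ := if h : i < n then x ⟨i, h⟩ else 0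

theorem extendZero_coe (x : Fin n → ℝ) (i : Fin n) : extendZero x i = x i := by
  simp [extendZero]

theorem extendZero_of_le (x : Fin n → ℝ) {i : ℕ} (h : n ≤ i) : extendZero x i = 0 := by
  simp [extendZero, h]

theorem tridiag_mulVec_eq (x : Fin n → ℝ) (i : Fin n) :
    (tridiag n α β *ᵥ x) i = triRow α β (extendZero x) i := by
  rw [← tridiag_mulVec _ fun _ => extendZero_of_le x]
  simp [extendZero_coe]

/-- The quadratic form of the leading section of size `J` of the tridiagonal matrix. -/
def triForm (α β g : ℕ → ℝ) (J : ℕ) : ℝ :=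
  ∑ i ∈ Finset.range J, α i * g i ^ 2 + 2 * ∑ i ∈ Finset.range (J - 1), β (i + 1) * g i * g (i + 1)

/-- The extra term is the coupling of the leading section to the next entry; it disappears for
sequences truncated after index `J`. -/
theorem sum_mul_triRow (g : ℕ → ℝ) (J : ℕ) :
    ∑ i ∈ Finset.range (J + 1), g i * triRow α β g i =
      triForm α β g (J + 1) + β (J + 1) * g J * g (J + 1) := by
  induction J with
  | zero => simp [triRow, triForm]; ring
  | succ J ih =>
    rw [Finset.sum_range_succ, ih, triRow_succ, triForm, triForm, Finset.sum_range_succ _ (J + 1)]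
    simp only [Nat.add_sub_cancel, Finset.sum_range_succ _ J]
    ring

theorem dotProduct_tridiag (g : ℕ → ℝ) {J : ℕ} (hJ : J < n) (hg : ∀ i, J < i → g i = 0) :
    (fun i : Fin n => g i) ⬝ᵥ (tridiag n α β *ᵥ fun j : Fin n => g j) =
      triForm α β g (J + 1) := by
  have hrow := tridiag_mulVec (n := n) (α := α) (β := β) g fun i hi => hg i (hJ.trans_le hi)
  simp only [dotProduct, hrow]
  rw [Fin.sum_univ_eq_sum_range (fun i => g i * triRow α β g i),
    ← Finset.sum_subset (Finset.range_subset_range.2 (show J + 1 ≤ n from hJ)), sum_mul_triRow,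
    hg (J + 1) (by omega), mul_zero, add_zero]
  intro i _ hi
  rw [hg i (by simpa using hi), zero_mul]

end Tridiagonal

/-! ### Conjugate gradients on a tridiagonal matrix, and orthogonal invariance. -/

section ConjugateGradient

variable {n : ℕ} {α β : ℕ → ℝ}

/-- The state of the conjugate gradient method for a tridiagonal matrix and a right-hand side
`b` proportional to the first unit vector: the residual is a multiple of a unit vector. -/
structure CGState.IsKrylov (T : Matrix (Fin n) (Fin n) ℝ) (b : Fin n → ℝ) (k : ℕ)
    (S : CGState n) : Prop where
  x_zero : ∀ i : Fin n, k ≤ i → S.x i = 0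
  r_eq : S.r = b - T *ᵥ S.x
  r_zero : ∀ i : Fin n, (i : ℕ) ≠ k → S.r i = 0
  r_ne : ∀ i : Fin n, (i : ℕ) = k → S.r i ≠ 0
  p_eq : ∀ i : Fin n, (i : ℕ) = k → S.p i = S.r i
  p_zero : ∀ i : Fin n, k < i → S.p i = 0
  Tp_zero : ∀ i : Fin n, (i : ℕ) < k → (T *ᵥ S.p) i = 0

/-- Since `T p` vanishes in the rows before `k`, the step length only has to cancel row `k` of the
residual; the fill-in of `T p` then puts the new residual in row `k + 1`. The choice of `δ` makes
row `k` of `T` times the new direction vanish. -/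
theorem CGState.IsKrylov.step (hβ : ∀ j, j < n → 0 < β j)
    (hpos : ∀ x : Fin n → ℝ, x ≠ 0 → 0 < x ⬝ᵥ (tridiag n α β *ᵥ x))
    {b : Fin n → ℝ} {k : ℕ} (hk : k < n) {S : CGState n}
    (hS : S.IsKrylov (tridiag n α β) b k) :
    (cgStep (tridiag n α β) S).IsKrylov (tridiag n α β) b (k + 1) := by
  set T := tridiag n α β with hT
  set ρ := S.r ⟨k, hk⟩ with hρ
  set c := (T *ᵥ S.p) ⟨k, hk⟩ with hc
  have hρ0 : ρ ≠ 0 := hS.r_ne _ rfl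
  have hpk : S.p ⟨k, hk⟩ = ρ := hS.p_eq _ rfl
  have hne : ∀ {i : Fin n}, i ≠ ⟨k, hk⟩ → (i : ℕ) ≠ k := fun h h' => h (Fin.ext h')
  have hrr : S.r ⬝ᵥ S.r = ρ ^ 2 := by
    rw [dotProduct, Finset.sum_eq_single ⟨k, hk⟩, sq]
    · intro i _ hi
      rw [hS.r_zero i (hne hi), zero_mul]
    · simp
  have hpTp : S.p ⬝ᵥ (T *ᵥ S.p) = ρ * c := by
    rw [dotProduct, Finset.sum_eq_single ⟨k, hk⟩, hpk]
    · intro i _ hi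
      rcases lt_or_gt_of_ne (hne hi) with h | h
      · rw [hS.Tp_zero i h, mul_zero]
      · rw [hS.p_zero i h, zero_mul]
    · simp
  have hp0 : S.p ≠ 0 := fun h => hρ0 (by rw [← hpk, h]; rfl)
  have hρc : 0 < ρ * c := hpTp ▸ hpos _ hp0
  have hc0 : c ≠ 0 := fun h => by simp [h] at hρc
  have hγ : (S.r ⬝ᵥ S.r) / (S.p ⬝ᵥ (T *ᵥ S.p)) = ρ / c := by
    rw [hrr, hpTp]
    field_simp
  have hpext : ∀ i, k < i → extendZero S.p i = 0 := by
    intro i hi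
    unfold extendZero
    split_ifs with h
    · exact hS.p_zero _ hi
    · rfl
  have hTp1 : ∀ i : Fin n, (i : ℕ) = k + 1 → (T *ᵥ S.p) i = β (k + 1) * ρ := by
    intro i hi
    rw [hT, tridiag_mulVec_eq, hi, triRow_succ, hpext (k + 1) (by omega),
      hpext (k + 2) (by omega), ← hpk, ← extendZero_coe S.p]
    ring
  have hTp2 : ∀ i : Fin n, k + 1 < i → (T *ᵥ S.p) i = 0 := by
    intro i hi
    obtain ⟨m, hm⟩ := Nat.exists_eq_succ_of_ne_zero (show (i : ℕ) ≠ 0 by omega)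
    rw [hT, tridiag_mulVec_eq, hm, Nat.succ_eq_add_one, triRow_succ, hpext m (by omega),
      hpext (m + 1) (by omega), hpext (m + 2) (by omega)]
    ring
  have hx : (cgStep T S).x = S.x + (ρ / c) • S.p := by rw [← hγ]; rfl
  have hr : (cgStep T S).r = S.r - (ρ / c) • (T *ᵥ S.p) := by rw [← hγ]; rfl
  have hr0 : ∀ i : Fin n, (i : ℕ) ≠ k + 1 → (cgStep T S).r i = 0 := by
    intro i hi
    rw [hr, Pi.sub_apply, Pi.smul_apply, smul_eq_mul]
    rcases lt_trichotomy (i : ℕ) k with h | h | h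
    · rw [hS.r_zero i h.ne, hS.Tp_zero i h, mul_zero, sub_zero]
    · obtain rfl : i = ⟨k, hk⟩ := Fin.ext h
      rw [← hρ, ← hc]
      field_simp
      ring
    · rw [hS.r_zero i h.ne', hTp2 i (by omega), mul_zero, sub_zero]
  have hr1 : ∀ i : Fin n, (i : ℕ) = k + 1 → (cgStep T S).r i = -(ρ ^ 2 / c * β (k + 1)) := by
    intro i hi
    rw [hr, Pi.sub_apply, Pi.smul_apply, smul_eq_mul, hS.r_zero i (by omega), hTp1 i hi]
    ring
  set δ := ((cgStep T S).r ⬝ᵥ (cgStep T S).r) / (S.r ⬝ᵥ S.r) with hδ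
  have hp : (cgStep T S).p = (cgStep T S).r + δ • S.p := rfl
  refine ⟨fun i hi => ?_, ?_, hr0, fun i hi => ?_, fun i hi => ?_, fun i hi => ?_, fun i hi => ?_⟩
  · rw [hx, Pi.add_apply, Pi.smul_apply, hS.x_zero i (by omega), hS.p_zero i (by omega),
      smul_zero, add_zero]
  · rw [hr, hx, mulVec_add, mulVec_smul, hS.r_eq]
    abel
  · rw [hr1 i hi]
    have := (hβ (k + 1) (hi ▸ i.2)).ne'
    exact neg_ne_zero.2 (mul_ne_zero (div_ne_zero (pow_ne_zero 2 hρ0) hc0) this)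
  · rw [hp, Pi.add_apply, Pi.smul_apply, hS.p_zero i (by omega), smul_zero, add_zero]
  · rw [hp, Pi.add_apply, Pi.smul_apply, hS.p_zero i (by omega), hr0 i (by omega), smul_zero,
      add_zero]
  · rw [hp, mulVec_add, mulVec_smul, Pi.add_apply, Pi.smul_apply, smul_eq_mul]
    have hrext : ∀ l, l ≠ k + 1 → extendZero (cgStep T S).r l = 0 := by
      intro l hl
      unfold extendZero
      split_ifs with h
      · exact hr0 _ hl
      · rfl
    -- For `i ≤ k` only the superdiagonal entry of row `k` can meet the new residual.
    have hTr : (T *ᵥ (cgStep T S).r) i = β (i + 1) * extendZero (cgStep T S).r (i + 1) := by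
      rw [hT, tridiag_mulVec_eq, ← hT, triRow, hrext i (by omega), hrext (i - 1) (by omega)]
      simp
    rw [hTr]
    rcases (Nat.lt_succ_iff.1 hi).lt_or_eq with h | h
    · rw [hS.Tp_zero i h, hrext _ (by omega)]
      simp
    · obtain rfl : i = ⟨k, hk⟩ := Fin.ext h
      rw [← hc]
      -- At the last step there is no row `k + 1`: the residual is zero, and so is `δ`.
      by_cases hk1 : k + 1 < n
      · have hδ' : δ = (ρ / c * β (k + 1)) ^ 2 := by
          rw [hδ, hrr, dotProduct, Finset.sum_eq_single ⟨k + 1, hk1⟩, hr1 _ rfl]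
          · field_simp
          · intro j _ hj
            rw [hr0 j fun h' => hj (Fin.ext h'), zero_mul]
          · simp
        have : extendZero (cgStep T S).r (k + 1) = -(ρ ^ 2 / c * β (k + 1)) := by
          rw [← hr1 ⟨k + 1, hk1⟩ rfl, ← extendZero_coe (cgStep T S).r]
        simp only [this, hδ']
        field_simp
        ring
      · have hδ' : δ = 0 := by
          rw [hδ, dotProduct, Finset.sum_eq_zero, zero_div]
          intro j _
          rw [hr0 j (by omega), zero_mul]
        simp only [hδ', extendZero_of_le (cgStep T S).r (not_lt.1 hk1)]
        ring

theorem cgState_isKrylov (hβ : ∀ j, j < n → 0 < β j)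
    (hpos : ∀ x : Fin n → ℝ, x ≠ 0 → 0 < x ⬝ᵥ (tridiag n α β *ᵥ x)) {k : ℕ} (hk : k ≤ n) :
    (cgState (tridiag n α β) (β 0 • firstUnitVec n) 0 k).IsKrylov (tridiag n α β)
      (β 0 • firstUnitVec n) k := by
  induction k with
  | zero =>
    refine ⟨fun i _ => rfl, rfl, fun i hi => ?_, fun i hi => ?_, fun i _ => rfl, fun i hi => ?_,
      fun i hi => absurd hi (Nat.not_lt_zero _)⟩
    · simp [cgState, firstUnitVec, hi]
    · simpa [cgState, firstUnitVec, hi] using (hβ 0 (hi ▸ i.2)).ne'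
    · simp [cgState, firstUnitVec, hi.ne']
  | succ k ih => exact (ih (by omega)).step hβ hpos hk

/-- The conjugate gradient method commutes with orthogonal transformations. -/
theorem cgState_orthogonal {P T : Matrix (Fin n) (Fin n) ℝ} (hP : Pᵀ * P = 1) (b : Fin n → ℝ)
    (k : ℕ) :
    cgState (P * T * Pᵀ) (P *ᵥ b) 0 k =
      { x := P *ᵥ (cgState T b 0 k).x
        r := P *ᵥ (cgState T b 0 k).r
        p := P *ᵥ (cgState T b 0 k).p } := by
  have hmul : ∀ x, (P * T * Pᵀ) *ᵥ (P *ᵥ x) = P *ᵥ (T *ᵥ x) := by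
    intro x
    rw [mulVec_mulVec, Matrix.mul_assoc, hP, Matrix.mul_one, ← mulVec_mulVec]
  have hdot : ∀ x y, (P *ᵥ x) ⬝ᵥ (P *ᵥ y) = x ⬝ᵥ y := by
    intro x y
    rw [dotProduct_mulVec, vecMul_mulVec, hP, vecMul_one]
  induction k with
  | zero => simp [cgState]
  | succ k ih =>
    simp only [cgState, ih, cgStep, hmul, hdot, ← mulVec_smul, ← mulVec_sub, ← mulVec_add]

end ConjugateGradient

/-! ### Lower bounds for the pivots. -/

section PivotBound

variable {α β : ℕ → ℝ}

/-- A lower bound `m` for the quadratic form of a tridiagonal matrix bounds its pivots. -/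
theorem pivot_lower_bound {D : ℕ → ℝ} {c m : ℝ} {k : ℕ} (hc : 0 < c) (hm : 0 < m)
    (hβ : ∀ j, j < k → 0 < β j)
    (hform : ∀ J, J < k → ∀ y : ℕ → ℝ, m * ∑ i ∈ Finset.range (J + 1), y i ^ 2 ≤
      ∑ i ∈ Finset.range (J + 1), α i * y i ^ 2 -
        2 * c * ∑ i ∈ Finset.range J, β (i + 1) * y i * y (i + 1))
    (h0 : α 0 ≤ D 0)
    (hD : ∀ j, j + 1 < k → 0 < D j → α (j + 1) - (c * β (j + 1)) ^ 2 / D j ≤ D (j + 1)) {j : ℕ}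
    (hj : j < k) : m ≤ D j := by
  -- For exact pivots of the matrix with off-diagonal `-cβ`, this vector is annihilated by every row
  -- of a leading section but the last, so its quadratic form telescopes to `D j * y j ^ 2`. The
  -- inequality in `hD` leaves `≤`.
  let y : ℕ → ℝ := fun j => Nat.rec 1 (fun i yi => yi * D i / (c * β (i + 1))) j
  have hy : ∀ i, y (i + 1) = y i * D i / (c * β (i + 1)) := fun _ => rfl
  have key : ∀ j, j < k → y j ≠ 0 ∧ ∑ i ∈ Finset.range (j + 1), α i * y i ^ 2 -
        2 * c * ∑ i ∈ Finset.range j, β (i + 1) * y i * y (i + 1) ≤ D j * y j ^ 2 := by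
    intro j
    induction j with
    | zero =>
      intro _
      have : y 0 = 1 := rfl
      simpa [this] using h0
    | succ j ih =>
      intro hj
      obtain ⟨hyj, hS⟩ := ih (by omega)
      have hy2 : 0 < y j ^ 2 := by positivity
      have hsum : y j ^ 2 ≤ ∑ i ∈ Finset.range (j + 1), y i ^ 2 :=
        Finset.single_le_sum (f := fun i => y i ^ 2) (fun i _ => sq_nonneg _) (by simp)
      have hDj : 0 < D j := by
        have h1 := (hform j (by omega) y).trans hS
        have h2 : 0 < D j * y j ^ 2 := by
          refine lt_of_lt_of_le ?_ h1
          have : 0 < ∑ i ∈ Finset.range (j + 1), y i ^ 2 := hy2.trans_le hsum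
          positivity
        exact pos_of_mul_pos_left h2 hy2.le
      have hβj := hβ (j + 1) hj
      refine ⟨by rw [hy]; positivity, ?_⟩
      rw [Finset.sum_range_succ _ (j + 1),
        Finset.sum_range_succ (fun i => β (i + 1) * y i * y (i + 1)) j]
      have h1 := mul_le_mul_of_nonneg_right (hD j hj hDj) (sq_nonneg (y (j + 1)))
      have h2 : D j * y j ^ 2 - 2 * c * (β (j + 1) * y j * y (j + 1)) =
          - ((c * β (j + 1)) ^ 2 / D j) * y (j + 1) ^ 2 := by
        rw [hy]
        field_simp
        ring
      linarith
  obtain ⟨hyj, hS⟩ := key j hj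
  have hy2 : 0 < y j ^ 2 := by positivity
  have hsum : y j ^ 2 ≤ ∑ i ∈ Finset.range (j + 1), y i ^ 2 :=
    Finset.single_le_sum (f := fun i => y i ^ 2) (fun i _ => sq_nonneg _) (by simp)
  have := (mul_le_mul_of_nonneg_left hsum hm.le).trans ((hform j hj y).trans hS)
  exact le_of_mul_le_mul_right this hy2

variable {n : ℕ} {Λ μ u : ℝ}

theorem triForm_bounds (hlow : ∀ x : Fin n → ℝ, x ⬝ᵥ x ≤ μ * (x ⬝ᵥ (tridiag n α β *ᵥ x)))
    (hup : ∀ x : Fin n → ℝ, x ⬝ᵥ (tridiag n α β *ᵥ x) ≤ Λ * (x ⬝ᵥ x)) {J : ℕ} (hJ : J < n)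
    (g : ℕ → ℝ) :
    ∑ i ∈ Finset.range (J + 1), g i ^ 2 ≤ μ * triForm α β g (J + 1) ∧
      triForm α β g (J + 1) ≤ Λ * ∑ i ∈ Finset.range (J + 1), g i ^ 2 := by
  -- Zero padding makes the form of a leading section a value of the full form.
  let g' : ℕ → ℝ := fun i => if i ≤ J then g i else 0
  have hg' : ∀ i, J < i → g' i = 0 := fun i hi => if_neg hi.not_ge
  have hform : triForm α β g' (J + 1) = triForm α β g (J + 1) := by
    unfold triForm
    congr 1
    · refine Finset.sum_congr rfl fun i hi => ?_
      have := Finset.mem_range.1 hi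
      simp [g', show i ≤ J by omega]
    · congr 1
      refine Finset.sum_congr rfl fun i hi => ?_
      have := Finset.mem_range.1 hi
      simp [g', show i ≤ J by omega, show i + 1 ≤ J by omega]
  have hsq : (fun i : Fin n => g' i) ⬝ᵥ (fun i : Fin n => g' i) =
      ∑ i ∈ Finset.range (J + 1), g i ^ 2 := by
    simp only [dotProduct]
    rw [Fin.sum_univ_eq_sum_range (fun i => g' i * g' i),
      ← Finset.sum_subset (Finset.range_subset_range.2 (show J + 1 ≤ n from hJ))]
    · refine Finset.sum_congr rfl fun i hi => ?_
      have := Finset.mem_range.1 hi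
      simp [g', show i ≤ J by omega, sq]
    · intro i _ hi
      rw [hg' i (by simpa using hi), zero_mul]
  have h1 := hlow fun i => g' i
  have h2 := hup fun i => g' i
  rw [dotProduct_tridiag g' hJ hg', hform, hsq] at h1 h2
  exact ⟨h1, h2⟩

/-- Increasing the off-diagonal entries by the factor `1 + 2u` keeps the quadratic form above
`4uΛ`. -/
theorem scaled_form_lower_bound (hu : 0 ≤ u) (hΛ : 0 ≤ Λ) (hμ : 0 < μ) (hκ : 5 * u * (Λ * μ) ≤ 1)
    (hlow : ∀ x : Fin n → ℝ, x ⬝ᵥ x ≤ μ * (x ⬝ᵥ (tridiag n α β *ᵥ x)))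
    (hup : ∀ x : Fin n → ℝ, x ⬝ᵥ (tridiag n α β *ᵥ x) ≤ Λ * (x ⬝ᵥ x)) {J : ℕ} (hJ : J < n)
    (y : ℕ → ℝ) :
    4 * u * Λ * ∑ i ∈ Finset.range (J + 1), y i ^ 2 ≤
      ∑ i ∈ Finset.range (J + 1), α i * y i ^ 2 -
        2 * (1 + 2 * u) * ∑ i ∈ Finset.range J, β (i + 1) * y i * y (i + 1) := by
  have hp := (triForm_bounds hlow hup hJ y).2
  -- Alternating signs turn the off-diagonal part into its negative, so `T` with negated
  -- off-diagonal obeys the same lower bound.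
  have hn := (triForm_bounds hlow hup hJ fun i => (-1) ^ i * y i).1
  have hsq : ∀ i, ((-1 : ℝ) ^ i * y i) ^ 2 = y i ^ 2 := by
    intro i
    rw [mul_pow, ← pow_mul, mul_comm i, pow_mul]
    norm_num
  have hcross : ∀ i, β (i + 1) * ((-1) ^ i * y i) * ((-1) ^ (i + 1) * y (i + 1)) =
      -(β (i + 1) * y i * y (i + 1)) := by
    intro i
    have : ((-1 : ℝ) ^ i) ^ 2 = 1 := by rw [← pow_mul, mul_comm i, pow_mul]; norm_num
    rw [pow_succ]
    linear_combination (-(β (i + 1) * y i * y (i + 1))) * this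
  simp only [triForm, Nat.add_sub_cancel, hsq, hcross, Finset.sum_neg_distrib] at hp hn
  set N := ∑ i ∈ Finset.range (J + 1), y i ^ 2
  set Q := ∑ i ∈ Finset.range (J + 1), α i * y i ^ 2
  set O := ∑ i ∈ Finset.range J, β (i + 1) * y i * y (i + 1)
  have hN : 0 ≤ N := Finset.sum_nonneg fun i _ => sq_nonneg _
  have hQO : 0 ≤ Q + 2 * -O := by
    by_contra! h
    nlinarith
  have h1 : 5 * u * (Λ * N) ≤ Q + 2 * -O :=
    calc 5 * u * (Λ * N) ≤ 5 * u * (Λ * (μ * (Q + 2 * -O))) := by gcongr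
      _ = 5 * u * (Λ * μ) * (Q + 2 * -O) := by ring
      _ ≤ 1 * (Q + 2 * -O) := by gcongr
      _ = Q + 2 * -O := one_mul _
  -- `Q + 2O ≤ ΛN` and `Q - 2O ≥ 0` give `4O ≤ ΛN`. The scaling thus costs `4uO ≤ uΛN` out of the
  -- available `5uΛN`.
  have h2 : u * (4 * O) ≤ u * (Λ * N) := by
    refine mul_le_mul_of_nonneg_left ?_ hu
    linarith
  linarith

end PivotBound

/-! ### Accumulation of relative errors. -/

section RelativeErrors

variable {F : BinaryFormat} {rd : ℝ → ℝ}

theorem BinaryFormat.IsRoundToNearest.exists_rel (hrd : F.IsRoundToNearest rd) {x : ℝ}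
    (hx : F.InRange x) :
    ∃ δ, rd x = x * (1 + δ) ∧ (1 + F.unitRoundoff) * |δ| ≤ F.unitRoundoff := by
  have h := (hrd.error_bounds hx).2
  rcases eq_or_ne x 0 with rfl | h0
  · exact ⟨0, by simp [hrd.map_zero], by simpa using F.unitRoundoff_pos.le⟩
  · refine ⟨(rd x - x) / x, by field_simp; ring, ?_⟩
    rwa [abs_div, mul_div_assoc', div_le_iff₀ (abs_pos.2 h0)]

theorem BinaryFormat.IsRoundToNearest.exists_rel' (hrd : F.IsRoundToNearest rd) {x : ℝ}
    (hx : F.InRange x) : ∃ δ, x = rd x * (1 + δ) ∧ |δ| ≤ F.unitRoundoff := by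
  have h := (hrd.error_bounds hx).1
  rcases eq_or_ne (rd x) 0 with h0 | h0
  · rw [h0, abs_zero, mul_zero] at h
    have := abs_eq_zero.1 (le_antisymm h (abs_nonneg _))
    exact ⟨0, by linarith, by simpa using F.unitRoundoff_pos.le⟩
  · refine ⟨(x - rd x) / rd x, by field_simp; ring, ?_⟩
    rwa [abs_div, div_le_iff₀ (abs_pos.2 h0), abs_sub_comm]

theorem abs_le_of_one_add_mul_le {u δ : ℝ} (hu : 0 ≤ u) (h : (1 + u) * |δ| ≤ u) : |δ| ≤ u := by
  nlinarith [abs_nonneg δ]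

theorem mul_one_add_bounds {u x lo hi δ : ℝ} (hu : u ≤ 1) (hlo : 0 ≤ lo) (h1 : lo ≤ x)
    (h2 : x ≤ hi) (hδ : |δ| ≤ u) : lo * (1 - u) ≤ x * (1 + δ) ∧ x * (1 + δ) ≤ hi * (1 + u) := by
  obtain ⟨h3, h4⟩ := abs_le.1 hδ
  constructor
  · exact mul_le_mul h1 (by linarith) (by linarith) (hlo.trans h1)
  · exact mul_le_mul h2 (by linarith) (by linarith) ((hlo.trans h1).trans h2)

/-- The upper side `(1 + u)⁴ ≤ 1 + 5u` is where `u ≤ 1/8` enters; the lower side is Bernoulli's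
inequality. -/
theorem abs_one_sub_prod_le {u a b c d : ℝ} (hu0 : 0 ≤ u) (hu : u ≤ 1 / 8) (ha : |a| ≤ u)
    (hb : |b| ≤ u) (hc : |c| ≤ u) (hd : |d| ≤ u) :
    |1 - (1 + a) * (1 + b) * (1 + c) * (1 + d)| ≤ 5 * u := by
  have hu1 : u ≤ 1 := by linarith
  have h0 : 0 ≤ 1 - u := by linarith
  obtain ⟨ha1, ha2⟩ := abs_le.1 ha
  obtain ⟨h1, h2⟩ := mul_one_add_bounds (lo := 1 - u) (x := 1 + a) (hi := 1 + u) hu1 h0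
    (by linarith) (by linarith) hb
  obtain ⟨h3, h4⟩ := mul_one_add_bounds hu1 (by positivity) h1 h2 hc
  obtain ⟨h5, h6⟩ := mul_one_add_bounds hu1 (by positivity) h3 h4 hd
  have h7 : (1 + u) * (1 + u) * (1 + u) * (1 + u) ≤ 1 + 5 * u := by
    have : u * (6 * u + 4 * u ^ 2 + u ^ 3) ≤ u * 1 := by
      refine mul_le_mul_of_nonneg_left ?_ hu0
      have e1 : u ^ 2 ≤ (1 / 8) ^ 2 := by gcongr
      have e2 : u ^ 3 ≤ (1 / 8) ^ 3 := by gcongr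
      linarith
    linarith
  have h8 : 1 - 4 * u ≤ (1 - u) * (1 - u) * (1 - u) * (1 - u) := by
    have := one_add_mul_le_pow (a := -u) (by linarith) 4
    push_cast at this
    linarith
  rw [abs_le]
  constructor <;> linarith

/-- The relative perturbation of a diagonal entry `D + q` whose pivot `D` is not too small. -/
theorem abs_diag_perturbation_le {u D q a₁ a₂ a₃ b₁ b₂ b₃ b₄ b₅ : ℝ} (hu0 : 0 ≤ u)
    (hu : u ≤ 1 / 8) (hq : 0 ≤ q) (hD : 4 * u * (D + q) ≤ D) (hD0 : 0 ≤ D)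
    (ha₁ : (1 + u) * |a₁| ≤ u) (ha₂ : |a₂| ≤ u) (ha₃ : |a₃| ≤ u)
    (hb₁ : (1 + u) * |b₁| ≤ u) (hb₂ : (1 + u) * |b₂| ≤ u) (hb₃ : (1 + u) * |b₃| ≤ u)
    (hb₄ : |b₄| ≤ u) (hb₅ : |b₅| ≤ u) :
    |D + q - (D * ((1 + a₁) * (1 + a₂) * (1 + a₃)) +
      q * ((1 + b₁) * (1 + b₂) * (1 + b₃) * (1 + b₄) * (1 + b₅)))| ≤ 5 * u * (D + q) := by
  have hu1 : u ≤ 1 := by linarith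
  have h0 : 0 ≤ 1 - u := by linarith
  have hp : 0 < 1 + u := by linarith
  set v := u / (1 + u) with hv
  have hvle : ∀ {δ : ℝ}, (1 + u) * |δ| ≤ u → |δ| ≤ v := by
    intro δ h
    rwa [hv, le_div_iff₀ hp, mul_comm]
  have hv0 : 0 ≤ v := by positivity
  have hvu : v ≤ u := by rw [hv, div_le_iff₀ hp]; nlinarith
  have hv1 : v ≤ 1 := by linarith
  obtain ⟨ha1, ha2⟩ := abs_le.1 (hvle ha₁)
  obtain ⟨ha3, ha4⟩ := mul_one_add_bounds (lo := 1 - v) (x := 1 + a₁) (hi := 1 + v) hu1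
    (by linarith) (by linarith) (by linarith) ha₂
  obtain ⟨ha5, ha6⟩ := mul_one_add_bounds hu1 (mul_nonneg (by linarith) h0) ha3 ha4 ha₃
  obtain ⟨hb1, hb2⟩ := abs_le.1 (hvle hb₁)
  obtain ⟨hb3, hb4⟩ := mul_one_add_bounds (lo := 1 - v) (x := 1 + b₁) (hi := 1 + v) hv1
    (by linarith) (by linarith) (by linarith) (hvle hb₂)
  have hw : 0 ≤ 1 - v := by linarith
  obtain ⟨hb5, hb6⟩ := mul_one_add_bounds hv1 (mul_nonneg hw hw) hb3 hb4 (hvle hb₃)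
  obtain ⟨hb7, hb8⟩ := mul_one_add_bounds hu1 (by positivity) hb5 hb6 hb₄
  obtain ⟨hb9, hb10⟩ := mul_one_add_bounds hu1 (by positivity) hb7 hb8 hb₅
  have hvv : (1 + v) = (1 + 2 * u) / (1 + u) := by rw [hv]; field_simp; ring
  have hA1 : (1 + v) * (1 + u) * (1 + u) = (1 + 2 * u) * (1 + u) := by
    rw [hvv]; field_simp
  have hB1 : (1 + v) * (1 + v) * (1 + v) * (1 + u) * (1 + u) = (1 + 2 * u) ^ 3 / (1 + u) := by
    rw [hvv]; field_simp
  have hA0 : 1 - 5 * u ≤ (1 - v) * (1 - u) * (1 - u) := by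
    have : (1 - u) * (1 - u) * (1 - u) ≤ (1 - v) * (1 - u) * (1 - u) := by gcongr
    have := one_add_mul_le_pow (a := -u) (by linarith) 3
    push_cast at this
    linarith
  have hB0 : 1 - 5 * u ≤ (1 - v) * (1 - v) * (1 - v) * (1 - u) * (1 - u) := by
    have : (1 - u) * (1 - u) * (1 - u) * (1 - u) * (1 - u) ≤
      (1 - v) * (1 - v) * (1 - v) * (1 - u) * (1 - u) := by gcongr
    have := one_add_mul_le_pow (a := -u) (by linarith) 5
    push_cast at this
    linarith
  rw [hA1] at ha6
  rw [hB1] at hb10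
  set X := (1 + a₁) * (1 + a₂) * (1 + a₃)
  set Y := (1 + b₁) * (1 + b₂) * (1 + b₃) * (1 + b₄) * (1 + b₅)
  have e1 := mul_le_mul_of_nonneg_left (hA0.trans ha5) hD0
  have e2 := mul_le_mul_of_nonneg_left (hB0.trans hb9) hq
  have e3 := mul_le_mul_of_nonneg_left ha6 hD0
  have e4 := mul_le_mul_of_nonneg_left hb10 hq
  have e5 : D * ((1 + 2 * u) * (1 + u)) + q * ((1 + 2 * u) ^ 3 / (1 + u)) ≤
      (1 + 5 * u) * (D + q) := by
    have f1 : q * ((1 + 2 * u) ^ 3 / (1 + u)) = q * (1 + 2 * u) ^ 3 / (1 + u) := by ring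
    rw [f1, ← le_sub_iff_add_le', div_le_iff₀ hp]
    -- The factor of `q` exceeds `1 + 5u` by `u² (7 + 8u) / (1 + u)`, while that of `D` falls short
    -- of it by `2u - 2u²`. The assumption `4u (D + q) ≤ D` lets this slack pay for the excess.
    have f2 : 0 ≤ (7 + 8 * u) * (D - 4 * u * (D + q)) := by
      refine mul_nonneg (by linarith) (by linarith)
    have f3 : 0 ≤ D * (1 + 20 * u + 24 * u ^ 2) := by positivity
    have f4 : 0 ≤ u / 4 * ((7 + 8 * u) * (D - 4 * u * (D + q)) + D * (1 + 20 * u + 24 * u ^ 2)) := by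
      positivity
    linarith
  rw [abs_le]
  constructor <;> linarith

end RelativeErrors

/-! ### Rounding error analysis of the `LDLᵀ` solution. -/

section LDL

variable {F : BinaryFormat} {rd : ℝ → ℝ} {α β : ℕ → ℝ} {c : ℝ} {k : ℕ}

/-- The pivots before the rounding of the final subtraction. -/
noncomputable def ldlExactPivot (rd : ℝ → ℝ) (α β : ℕ → ℝ) : ℕ → ℝ
  | 0 => α 0
  | j + 1 => α (j + 1) - rd (β (j + 1) * ldlL rd α β j)

/-- The computed solution extended by zero. -/
noncomputable def ldlSol (rd : ℝ → ℝ) (α β : ℕ → ℝ) (c : ℝ) (k j : ℕ) : ℝ :=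
  if j < k then ldlY rd α β c k j else 0

theorem ldlY_last (hj : j + 1 = k) : ldlY rd α β c k j = ldlW rd α β c j := by
  have : k - 1 - j = 0 := by omega
  rw [ldlY, this, ldlBack]

theorem ldlY_of_lt {j : ℕ} (hj : j + 1 < k) : ldlY rd α β c k j =
    rd (ldlW rd α β c j - rd (ldlL rd α β j * ldlY rd α β c k (j + 1))) := by
  have : k - 1 - j = (k - 1 - (j + 1)) + 1 := by omega
  rw [ldlY, this, ldlBack, ldlY]

theorem rel_pos {u x y : ℝ} (hu : 0 < u) (hx : 0 < x) (h : (1 + u) * |y - x| ≤ u * |x|) :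
    0 < y ∧ x ≤ (1 + u) * y ∧ (1 + u) * y ≤ (1 + 2 * u) * x := by
  rw [abs_of_pos hx] at h
  have h1 := mul_le_mul_of_nonneg_left (le_abs_self (y - x)) (by linarith : 0 ≤ 1 + u)
  have h2 := mul_le_mul_of_nonneg_left (neg_abs_le (y - x)) (by linarith : 0 ≤ 1 + u)
  have h3 : x ≤ (1 + u) * y := by linarith
  exact ⟨pos_of_mul_pos_right (hx.trans_le h3) (by linarith), h3, by linarith⟩

theorem abs_mul_ldlSol (hβ : ∀ j, j < k → 0 < β j) (j : ℕ) :
    |β j * ldlSol rd α β c k j| = β j * |ldlSol rd α β c k j| := by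
  unfold ldlSol
  split_ifs with h
  · rw [abs_mul, abs_of_pos (hβ j h)]
  · simp

variable (hrd : F.IsRoundToNearest rd) (hsolve : LDLSolveInRange rd α β c F k)

include hrd hsolve

theorem LDLSolveInRange.ldlD_pos {j : ℕ} (hj : j < k) (h : 0 < ldlExactPivot rd α β j) :
    0 < ldlD rd α β j ∧ ldlExactPivot rd α β j ≤ (1 + F.unitRoundoff) * ldlD rd α β j := by
  have hu := F.unitRoundoff_pos
  cases j with
  | zero =>
    simp only [ldlExactPivot, ldlD] at h ⊢
    exact ⟨h, by nlinarith⟩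
  | succ j =>
    have := rel_pos hu h (hrd.error_bounds (hsolve.pivot_sub j hj)).2
    exact ⟨this.1, this.2.1⟩

/-- The factor `1 + 2u` on `β` absorbs the roundings of the previous pivot, the multiplier and the
product, so the computed recurrence dominates that of exact elimination with enlarged off-diagonal,
as `pivot_lower_bound` requires. -/
theorem LDLSolveInRange.multiplier {j : ℕ} (hj : j + 1 < k) (hβ : 0 < β (j + 1))
    (h : 0 < ldlExactPivot rd α β j) :
    0 < rd (β (j + 1) * ldlL rd α β j) ∧
      rd (β (j + 1) * ldlL rd α β j) ≤
        ((1 + 2 * F.unitRoundoff) * β (j + 1)) ^ 2 / ldlExactPivot rd α β j := by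
  set u := F.unitRoundoff
  have hu : 0 < u := F.unitRoundoff_pos
  obtain ⟨hd, hdt⟩ := hsolve.ldlD_pos hrd (by omega) h
  obtain ⟨hl, -, hl2⟩ := rel_pos hu (div_pos hβ hd) (hrd.error_bounds (hsolve.mult j hj)).2
  obtain ⟨hq, -, hq2⟩ := rel_pos hu (mul_pos hβ hl) (hrd.error_bounds (hsolve.pivot_mul j hj)).2
  refine ⟨hq, ?_⟩
  change (1 + u) * ldlL rd α β j ≤ _ at hl2
  change (1 + u) * rd (β (j + 1) * ldlL rd α β j) ≤ (1 + 2 * u) * (β (j + 1) * ldlL rd α β j) at hq2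
  rw [mul_div_assoc', le_div_iff₀ hd] at hl2
  rw [le_div_iff₀ h]
  set q := rd (β (j + 1) * ldlL rd α β j)
  set l := ldlL rd α β j
  set d := ldlD rd α β j
  set D := ldlExactPivot rd α β j
  set b := β (j + 1)
  have hl0 : 0 < l := hl
  calc q * D ≤ q * ((1 + u) * d) := by gcongr
    _ = (1 + u) * q * d := by ring
    _ ≤ (1 + 2 * u) * (b * l) * d := by gcongr
    _ ≤ (1 + 2 * u) * b * ((1 + u) * l * d) := by
        have : 0 ≤ (1 + 2 * u) * b * (l * d) * u := by positivity
        linarith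
    _ ≤ (1 + 2 * u) * b * ((1 + 2 * u) * b) := by gcongr
    _ = ((1 + 2 * u) * b) ^ 2 := by ring

theorem LDLSolveInRange.ldlY_isFloat {j : ℕ} (hj : j < k) : F.IsFloat (ldlY rd α β c k j) := by
  rcases (Nat.succ_le_of_lt hj).lt_or_eq with h | h
  · rw [ldlY_of_lt h]
    exact hrd.isFloat (hsolve.back_sub j h)
  · rw [ldlY_last h]
    exact hrd.isFloat (hsolve.diag_div j hj)

/-- Errors of the quotient and the subtraction are taken relative to the computed values, so they
enter as factors when the operations are undone. The product keeps the sharper bound `u / (1 + u)`,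
needed in `abs_diag_perturbation_le`. -/
theorem LDLSolveInRange.backward {j : ℕ} (hj : j < k) (hd : 0 < ldlD rd α β j) :
    ∃ δ₁ δ₂ δ₃ : ℝ, |δ₁| ≤ F.unitRoundoff ∧ |δ₂| ≤ F.unitRoundoff ∧
      (1 + F.unitRoundoff) * |δ₃| ≤ F.unitRoundoff ∧
      ldlZ rd α β c j = ldlD rd α β j * (1 + δ₁) * (ldlSol rd α β c k j * (1 + δ₂) +
        ldlL rd α β j * ldlSol rd α β c k (j + 1) * (1 + δ₃)) := by
  have hu := F.unitRoundoff_pos.le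
  obtain ⟨δ₁, h₁, h₁'⟩ := hrd.exists_rel' (hsolve.diag_div j hj)
  have hz : ldlZ rd α β c j = ldlD rd α β j * (1 + δ₁) * ldlW rd α β c j := by
    rw [div_eq_iff hd.ne'] at h₁
    rw [h₁, ldlW]
    ring
  rcases (Nat.succ_le_of_lt hj).lt_or_eq with h | h
  · have h' : j + 1 < k := h
    obtain ⟨δ₃, h₃, h₃'⟩ := hrd.exists_rel (hsolve.back_mul j h)
    obtain ⟨δ₂, h₂, h₂'⟩ := hrd.exists_rel' (hsolve.back_sub j h)
    refine ⟨δ₁, δ₂, δ₃, h₁', h₂', h₃', ?_⟩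
    rw [← ldlY_of_lt (rd := rd) (α := α) (β := β) (c := c) h', sub_eq_iff_eq_add, h₃] at h₂
    rw [ldlSol, ldlSol, if_pos hj, if_pos h', hz, h₂]
  · refine ⟨δ₁, 0, 0, h₁', by simpa using hu, by simpa using hu, ?_⟩
    have h' : ¬ j + 1 < k := by simpa using h.ge
    rw [ldlSol, ldlSol, if_pos hj, if_neg h', hz, ldlY_last h]
    ring

theorem LDLSolveInRange.offDiag {j : ℕ} (hd : 0 < ldlD rd α β j) :
    ∃ δ : ℝ, |δ| ≤ F.unitRoundoff ∧
      ldlD rd α β j * ldlL rd α β j * ldlSol rd α β c k (j + 1) =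
        β (j + 1) * (1 + δ) * ldlSol rd α β c k (j + 1) := by
  have hu := F.unitRoundoff_pos.le
  by_cases h : j + 1 < k
  · obtain ⟨δ, h₁, h₂⟩ := hrd.exists_rel (hsolve.mult j h)
    refine ⟨δ, abs_le_of_one_add_mul_le hu h₂, ?_⟩
    rw [ldlL, h₁]
    field_simp
  · exact ⟨0, by simpa using hu, by simp [ldlSol, h]⟩

theorem LDLSolveInRange.residual_zero (hu8 : F.unitRoundoff ≤ 1 / 8) (hk : 0 < k) (hα : 0 < α 0)
    (hβ : ∀ j, j < k → 0 < β j) :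
    |c - triRow α β (ldlSol rd α β c k) 0| ≤
      5 * F.unitRoundoff * triRow α β (fun i => |ldlSol rd α β c k i|) 0 := by
  have hu := F.unitRoundoff_pos.le
  obtain ⟨δ₁, δ₂, δ₃, h₁, h₂, h₃, hz⟩ := hsolve.backward hrd hk hα
  obtain ⟨δ, h₄, hl⟩ := hsolve.offDiag hrd (j := 0) hα
  have e1 := abs_one_sub_prod_le hu hu8 h₁ h₂ (abs_zero.trans_le hu) (abs_zero.trans_le hu)
  have e2 := abs_one_sub_prod_le hu hu8 h₁ (abs_le_of_one_add_mul_le hu h₃) h₄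
    (abs_zero.trans_le hu)
  rw [triRow_zero, triRow_zero]
  simp only [ldlZ, ldlD, zero_add] at hz hl
  set y₀ := ldlSol rd α β c k 0
  set y₁ := ldlSol rd α β c k 1
  have : c - (α 0 * y₀ + β 1 * y₁) =
      -((1 - (1 + δ₁) * (1 + δ₂) * (1 + 0) * (1 + 0)) * (α 0 * y₀) +
        (1 - (1 + δ₁) * (1 + δ₃) * (1 + δ) * (1 + 0)) * (β 1 * y₁)) := by
    linear_combination hz + (1 + δ₁) * (1 + δ₃) * hl
  rw [this, abs_neg]
  refine (abs_add_le _ _).trans ?_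
  have m1 := mul_le_mul_of_nonneg_right e1 (abs_nonneg (α 0 * y₀))
  have m2 := mul_le_mul_of_nonneg_right e2 (abs_nonneg (β 1 * y₁))
  rw [← abs_mul, abs_mul (α 0), abs_of_pos hα] at m1
  rw [← abs_mul, abs_mul_ldlSol hβ] at m2
  linarith

/-- Undoing back substitution in rows `j` and `j + 1` and inserting both into the forward recurrence
gives a perturbed row of `T`. Each off-diagonal entry carries at most four rounding factors; the
diagonal, split as `D + q`, carries three and five. -/
theorem LDLSolveInRange.residual_succ (hu8 : F.unitRoundoff ≤ 1 / 8) {j : ℕ} (hj : j + 1 < k)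
    (hβ : ∀ j, j < k → 0 < β j)
    (hD : 0 < ldlExactPivot rd α β j)
    (hD' : 4 * F.unitRoundoff * α (j + 1) ≤ ldlExactPivot rd α β (j + 1))
    (hD0 : 0 < ldlExactPivot rd α β (j + 1)) :
    |triRow α β (ldlSol rd α β c k) (j + 1)| ≤
      5 * F.unitRoundoff * triRow α β (fun i => |ldlSol rd α β c k i|) (j + 1) := by
  have hu := F.unitRoundoff_pos.le
  obtain ⟨hd, -⟩ := hsolve.ldlD_pos hrd (by omega) hD
  obtain ⟨hd', -⟩ := hsolve.ldlD_pos hrd hj hD0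
  obtain ⟨a₁, a₂, a₃, ha₁, ha₂, ha₃, hz⟩ := hsolve.backward hrd (by omega) hd
  obtain ⟨b₁, b₂, b₃, hb₁, hb₂, hb₃, hz'⟩ := hsolve.backward hrd hj hd'
  obtain ⟨b₄, hb₄, hoff⟩ := hsolve.offDiag hrd hd'
  obtain ⟨δ₁, h₁, h₁'⟩ := hrd.exists_rel (hsolve.mult j hj)
  obtain ⟨δ₂, h₂, h₂'⟩ := hrd.exists_rel' (hsolve.pivot_mul j hj)
  obtain ⟨δ₃, h₃, h₃'⟩ := hrd.exists_rel (hsolve.pivot_sub j hj)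
  obtain ⟨δ₄, h₄, h₄'⟩ := hrd.exists_rel (hsolve.forward_mul j hj)
  have hq := (hsolve.multiplier hrd hj (hβ _ hj) hD).1
  have hz1 : ldlZ rd α β c (j + 1) = -(ldlL rd α β j * ldlZ rd α β c j * (1 + δ₄)) := by
    -- Subtraction from zero is exact, so forward substitution contributes only the error of its
    -- product.
    rw [ldlZ, zero_sub, hrd.eq_self (hrd.isFloat (hsolve.forward_mul j hj)).neg, h₄]
  have hl : ldlD rd α β j * ldlL rd α β j = β (j + 1) * (1 + δ₁) := by
    rw [ldlL, h₁]
    field_simp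
  have hd1 : ldlD rd α β (j + 1) = ldlExactPivot rd α β (j + 1) * (1 + δ₃) := h₃
  have hαq : α (j + 1) = ldlExactPivot rd α β (j + 1) + rd (β (j + 1) * ldlL rd α β j) := by
    simp [ldlExactPivot]
  set q := rd (β (j + 1) * ldlL rd α β j)
  set l := ldlL rd α β j
  set l' := ldlL rd α β (j + 1)
  set d := ldlD rd α β j
  set d' := ldlD rd α β (j + 1)
  set D := ldlExactPivot rd α β (j + 1)
  set z := ldlZ rd α β c j
  set z' := ldlZ rd α β c (j + 1)
  rw [triRow_succ, triRow_succ]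
  rw [show j + 1 + 1 = j + 2 from rfl] at *
  set y₀ := ldlSol rd α β c k j
  set y₁ := ldlSol rd α β c k (j + 1)
  set y₂ := ldlSol rd α β c k (j + 2)
  have e0 := abs_one_sub_prod_le hu hu8 (abs_le_of_one_add_mul_le hu h₁')
    (abs_le_of_one_add_mul_le hu h₄') ha₁ ha₂
  have e1 := abs_diag_perturbation_le hu hu8 hq.le (by rwa [← hαq]) hD0.le h₃' hb₁ hb₂ h₁' h₄' ha₃
    h₂' ha₁
  have e2 := abs_one_sub_prod_le hu hu8 hb₁ (abs_le_of_one_add_mul_le hu hb₃) hb₄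
    (abs_zero.trans_le hu)
  rw [← hαq] at e1
  have hM : l * (d * l) = q * (1 + δ₂) * (1 + δ₁) := by
    rw [hl, ← h₂]
    ring
  have : β (j + 1) * y₀ + α (j + 1) * y₁ + β (j + 2) * y₂ =
      (1 - (1 + δ₁) * (1 + δ₄) * (1 + a₁) * (1 + a₂)) * (β (j + 1) * y₀) +
      (α (j + 1) - (D * ((1 + δ₃) * (1 + b₁) * (1 + b₂)) +
        q * ((1 + δ₁) * (1 + δ₄) * (1 + a₃) * (1 + δ₂) * (1 + a₁)))) * y₁ +
      (1 - (1 + b₁) * (1 + b₃) * (1 + b₄) * (1 + 0)) * (β (j + 2) * y₂) := by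
    have hzero : z' + l * z * (1 + δ₄) = 0 := by rw [hz1]; ring
    rw [hz', hz] at hzero
    linear_combination hzero - (1 + δ₄) * (1 + a₁) * (1 + a₂) * y₀ * hl
      - (1 + δ₄) * (1 + a₁) * (1 + a₃) * y₁ * hM - (1 + b₁) * (1 + b₂) * y₁ * hd1
      - (1 + b₁) * (1 + b₃) * hoff
  rw [this]
  refine (abs_add_three _ _ _).trans ?_
  have m0 := mul_le_mul_of_nonneg_right e0 (abs_nonneg (β (j + 1) * y₀))
  have m1 := mul_le_mul_of_nonneg_right e1 (abs_nonneg y₁)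
  have m2 := mul_le_mul_of_nonneg_right e2 (abs_nonneg (β (j + 2) * y₂))
  rw [← abs_mul, abs_mul (β (j + 1)), abs_of_pos (hβ _ hj)] at m0
  rw [← abs_mul] at m1
  rw [← abs_mul, abs_mul_ldlSol hβ] at m2
  linarith

end LDL

/-! ### Euclidean and spectral norms. -/

section Norms

variable {n : ℕ}

theorem dotProduct_self_eq_norm_sq (x : Fin n → ℝ) : x ⬝ᵥ x = ‖WithLp.toLp 2 x‖ ^ 2 := by
  rw [EuclideanSpace.norm_sq_eq]
  simp [dotProduct, sq]

theorem norm_toLp_abs (x : Fin n → ℝ) : ‖WithLp.toLp 2 fun i => |x i|‖ = ‖WithLp.toLp 2 x‖ := by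
  simp [EuclideanSpace.norm_eq]

theorem dotProduct_mulVec_le (A : Matrix (Fin n) (Fin n) ℝ) (x y : Fin n → ℝ) :
    x ⬝ᵥ (A *ᵥ y) ≤ ‖toEuclideanCLM (n := Fin n) (𝕜 := ℝ) A‖ * ‖WithLp.toLp 2 x‖ *
      ‖WithLp.toLp 2 y‖ := by
  have h1 := real_inner_le_norm (WithLp.toLp 2 x)
    (toEuclideanCLM (n := Fin n) (𝕜 := ℝ) A (WithLp.toLp 2 y))
  rw [inner_toEuclideanCLM] at h1
  have h2 := (toEuclideanCLM (n := Fin n) (𝕜 := ℝ) A).le_opNorm (WithLp.toLp 2 y)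
  calc _ ≤ _ := h1
    _ ≤ ‖WithLp.toLp 2 x‖ * (‖toEuclideanCLM (n := Fin n) (𝕜 := ℝ) A‖ * ‖WithLp.toLp 2 y‖) := by
      gcongr
    _ = _ := by ring

/-- The quadratic form of a positive definite matrix is bounded below by `1 / ‖A⁻¹‖`. -/
theorem Matrix.PosDef.dotProduct_self_le {A : Matrix (Fin n) (Fin n) ℝ} (hA : A.PosDef)
    (x : Fin n → ℝ) :
    x ⬝ᵥ x ≤ ‖toEuclideanCLM (n := Fin n) (𝕜 := ℝ) A⁻¹‖ * (x ⬝ᵥ (A *ᵥ x)) := by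
  set μ := ‖toEuclideanCLM (n := Fin n) (𝕜 := ℝ) A⁻¹‖ with hμ
  have hAB : A *ᵥ (A⁻¹ *ᵥ x) = x := by
    rw [mulVec_mulVec, mul_nonsing_inv _ ((isUnit_iff_isUnit_det _).1 hA.isUnit), one_mulVec]
  have hsymm : (A⁻¹ *ᵥ x) ⬝ᵥ (A *ᵥ x) = x ⬝ᵥ x := by
    have hT : Aᵀ = A := by simpa using hA.isHermitian.eq
    rw [dotProduct_mulVec, ← mulVec_transpose, hT, hAB]
  have hle := dotProduct_mulVec_le A⁻¹ x x
  -- Expanding the form at `μx - A⁻¹x` gives `2μ x·x ≤ μ² x·Ax + x·A⁻¹x`. Since `x·A⁻¹x ≤ μ x·x`,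
  -- division by `μ` yields the claim without spectral theory.
  have hpsd := hA.posSemidef.dotProduct_mulVec_nonneg (μ • x - A⁻¹ *ᵥ x)
  simp only [star_trivial, mulVec_sub, mulVec_smul, hAB, sub_dotProduct, dotProduct_sub,
    smul_dotProduct, dotProduct_smul, smul_eq_mul, hsymm, dotProduct_comm (A⁻¹ *ᵥ x) x] at hpsd
  rw [mul_assoc, ← sq, ← dotProduct_self_eq_norm_sq] at hle
  have hμ0 : 0 ≤ μ := norm_nonneg _
  rcases hμ0.eq_or_lt with h0 | h0
  · rw [← h0, zero_mul]
    have hz : A⁻¹ *ᵥ x = 0 := by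
      have := (toEuclideanCLM (n := Fin n) (𝕜 := ℝ) A⁻¹).le_opNorm (WithLp.toLp 2 x)
      rw [← hμ, ← h0, zero_mul, toEuclideanCLM_toLp] at this
      simpa using norm_le_zero_iff.1 this
    rw [← hAB, hz, mulVec_zero, zero_dotProduct]
  · nlinarith

end Norms

/-! ### Forward error of the tridiagonal solution. -/

section StructuredProblem

variable {F : BinaryFormat} {rd : ℝ → ℝ} {n k : ℕ} {α β : ℕ → ℝ} {Λ μ : ℝ}

/-- Forward error of the computed solution of the tridiagonal system with respect to the conjugate
gradient approximation. -/
theorem ldlSol_error (hrd : F.IsRoundToNearest rd) (hk : 0 < k) (hkn : k ≤ n)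
    (hβ : ∀ j, j < n → 0 < β j) (hsolve : LDLSolveInRange rd α β (β 0) F k)
    (hpos : ∀ x : Fin n → ℝ, x ≠ 0 → 0 < x ⬝ᵥ (tridiag n α β *ᵥ x))
    (hΛ : 0 ≤ Λ) (hμ : 0 ≤ μ)
    (hlow : ∀ x : Fin n → ℝ, x ⬝ᵥ x ≤ μ * (x ⬝ᵥ (tridiag n α β *ᵥ x)))
    (hup : ∀ x y : Fin n → ℝ, x ⬝ᵥ (tridiag n α β *ᵥ y) ≤
      Λ * ‖WithLp.toLp 2 x‖ * ‖WithLp.toLp 2 y‖)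
    (hκ : 5 * F.unitRoundoff * (Λ * μ) < 1) :
    (∀ j, j < k → ldlD rd α β j ≠ 0) ∧
      ‖WithLp.toLp 2 ((cgState (tridiag n α β) (β 0 • firstUnitVec n) 0 k).x -
        fun i : Fin n => ldlSol rd α β (β 0) k i)‖ ≤
      5 * F.unitRoundoff * (Λ * μ) *
        ‖WithLp.toLp 2 fun i : Fin n => ldlSol rd α β (β 0) k i‖ := by
  set u := F.unitRoundoff with hu_def
  have hu : 0 < u := F.unitRoundoff_pos
  have hup' : ∀ x : Fin n → ℝ, x ⬝ᵥ (tridiag n α β *ᵥ x) ≤ Λ * (x ⬝ᵥ x) := by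
    intro x
    rw [dotProduct_self_eq_norm_sq, sq, ← mul_assoc]
    exact hup x x
  have hdiag : ∀ j : Fin n, 1 ≤ μ * α j ∧ α j ≤ Λ := by
    intro j
    have h1 := hlow (Pi.single j 1)
    have h2 := hup' (Pi.single j 1)
    simp only [single_one_dotProduct, mulVec_single_one, col_apply, Pi.single_eq_same] at h1 h2
    have h3 : tridiag n α β j j = α j := by simp [tridiag]
    rw [h3] at h1 h2
    exact ⟨h1, by linarith⟩
  obtain ⟨hd1, hd2⟩ := hdiag ⟨0, hk.trans_le hkn⟩
  have hμ0 : 0 < μ := hμ.lt_of_ne fun h => by rw [← h, zero_mul] at hd1; linarith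
  have hΛμ : 1 ≤ Λ * μ := by
    rw [mul_comm]
    exact hd1.trans (mul_le_mul_of_nonneg_left hd2 hμ)
  have hΛ0 : 0 < Λ := hΛ.lt_of_ne fun h => by rw [← h, zero_mul] at hΛμ; linarith
  -- As `Λμ ≥ 1`, the hypothesis gives `u < 1/5`, and `u` is a power of two.
  have hu8 : u ≤ 1 / 8 := by
    have h5 : 5 * u < 1 := by nlinarith
    have hN : (0 : ℝ) < 2 ^ F.p := by positivity
    have h6 : (5 : ℝ) < 2 ^ F.p := by
      rw [hu_def, BinaryFormat.unitRoundoff, ← div_eq_mul_inv, div_lt_one hN] at h5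
      exact h5
    have hp : 3 ≤ F.p := by
      by_contra! h
      have : (2 : ℝ) ^ F.p ≤ 2 ^ 2 := pow_le_pow_right₀ (by norm_num) (by omega)
      linarith
    rw [hu_def, BinaryFormat.unitRoundoff, one_div]
    refine inv_anti₀ (by norm_num) ?_
    calc (8 : ℝ) = 2 ^ 3 := by norm_num
      _ ≤ 2 ^ F.p := pow_le_pow_right₀ (by norm_num) hp
  have hm : 0 < 4 * u * Λ := by positivity
  have hβk : ∀ j, j < k → 0 < β j := fun j hj => hβ j (hj.trans_le hkn)
  have hpiv : ∀ j, j < k → 4 * u * Λ ≤ ldlExactPivot rd α β j := by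
    intro j hj
    refine pivot_lower_bound (c := 1 + 2 * u) (D := ldlExactPivot rd α β) (by linarith) hm hβk
      (fun J hJ y => scaled_form_lower_bound hu.le hΛ hμ0 hκ.le hlow hup' (hJ.trans_le hkn) y)
      le_rfl (fun j hj hD => ?_) hj
    exact sub_le_sub_left (hsolve.multiplier hrd hj (hβk _ hj) hD).2 _
  have hpiv0 : ∀ j, j < k → 0 < ldlExactPivot rd α β j := fun j hj => hm.trans_le (hpiv j hj)
  refine ⟨fun j hj => (hsolve.ldlD_pos hrd hj (hpiv0 j hj)).1.ne', ?_⟩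
  set y := ldlSol rd α β (β 0) k with hy
  have hysupp : ∀ i, k ≤ i → y i = 0 := fun i hi => if_neg hi.not_gt
  have hK := cgState_isKrylov hβ hpos hkn
  set x := (cgState (tridiag n α β) (β 0 • firstUnitVec n) 0 k).x with hx
  set T := tridiag n α β with hT
  set e : Fin n → ℝ := x - fun i : Fin n => y i with he
  have hTy : ∀ i : Fin n, (T *ᵥ fun i : Fin n => y i) i = triRow α β y i :=
    tridiag_mulVec y fun i hi => hysupp i (hkn.trans hi)
  have hTabs : ∀ i : Fin n, (T *ᵥ fun i : Fin n => |y i|) i = triRow α β (fun i => |y i|) i :=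
    tridiag_mulVec (fun i => |y i|) fun i hi => by simp [hysupp i (hkn.trans hi)]
  have hres : ∀ i : Fin n, (i : ℕ) < k →
      |(T *ᵥ e) i| ≤ 5 * u * (T *ᵥ fun i : Fin n => |y i|) i := by
    intro i hi
    have h1 : (T *ᵥ x) i = β 0 * firstUnitVec n i := by
      have h := hK.r_zero i hi.ne
      rw [hK.r_eq, Pi.sub_apply, sub_eq_zero] at h
      exact h.symm
    rw [he, mulVec_sub, Pi.sub_apply, h1, hTy, hTabs, firstUnitVec]
    obtain ⟨i, hin⟩ := i
    cases i with
    | zero =>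
      simpa using hsolve.residual_zero hrd hu8 hk (hpiv0 0 hk) hβk
    | succ j =>
      have hj : j + 1 < k := hi
      have hα : 4 * u * α (j + 1) ≤ 4 * u * Λ :=
        mul_le_mul_of_nonneg_left (hdiag ⟨j + 1, hin⟩).2 (by positivity)
      simpa using hsolve.residual_succ hrd hu8 hj hβk (hpiv0 j (by omega)) (hα.trans (hpiv _ hj))
        (hpiv0 _ hj)
  -- Rows beyond `k` have no residual bound, but `e` vanishes there.
  have hee : e ⬝ᵥ (T *ᵥ e) ≤ 5 * u * (Λ * ‖WithLp.toLp 2 e‖ * ‖WithLp.toLp 2 fun i : Fin n => y i‖) := by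
    have h1 := hup (fun i => |e i|) (fun i : Fin n => |y i|)
    rw [norm_toLp_abs, norm_toLp_abs fun i : Fin n => y i] at h1
    refine le_trans ?_ (mul_le_mul_of_nonneg_left h1 (by positivity))
    rw [dotProduct, dotProduct, Finset.mul_sum]
    refine Finset.sum_le_sum fun i _ => ?_
    rcases lt_or_ge (i : ℕ) k with hi | hi
    · calc e i * (T *ᵥ e) i ≤ |e i| * |(T *ᵥ e) i| := by
            rw [← abs_mul]
            exact le_abs_self _
        _ ≤ |e i| * (5 * u * (T *ᵥ fun i : Fin n => |y i|) i) := by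
            gcongr
            exact hres i hi
        _ = _ := by ring
    · have : e i = 0 := by
        have hxi : x i = 0 := hK.x_zero i hi
        rw [he, Pi.sub_apply, hxi, hysupp i hi, sub_zero]
      simp [this]
  have hle := (hlow e).trans (mul_le_mul_of_nonneg_left hee hμ)
  rw [dotProduct_self_eq_norm_sq] at hle
  rcases (norm_nonneg (WithLp.toLp 2 e)).eq_or_lt with h0 | h0
  · rw [← h0]
    positivity
  · refine le_of_mul_le_mul_left ?_ h0
    linarith

theorem tridiag_congr {α' β' : ℕ → ℝ} (hα : ∀ j, j < n → α j = α' j)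
    (hβ : ∀ j, j < n → β j = β' j) : tridiag n α β = tridiag n α' β' := by
  ext i j
  simp only [tridiag, of_apply, hα i i.2, hβ i i.2, hβ j j.2]

/-- The conjugate gradient approximations to a nonzero right-hand side are nonzero. -/
theorem cgX_tridiag_ne_zero (hk : 0 < k) (hkn : k ≤ n) (hβ : ∀ j, j < n → 0 < β j)
    (hpos : ∀ x : Fin n → ℝ, x ≠ 0 → 0 < x ⬝ᵥ (tridiag n α β *ᵥ x)) :
    (cgState (tridiag n α β) (β 0 • firstUnitVec n) 0 k).x ≠ 0 := by
  intro h
  have hK := cgState_isKrylov hβ hpos hkn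
  have h0 := hK.r_zero ⟨0, hk.trans_le hkn⟩ hk.ne
  rw [hK.r_eq, h, mulVec_zero, sub_zero] at h0
  have := hβ 0 (hk.trans_le hkn)
  simp [firstUnitVec] at h0
  linarith

end StructuredProblem

/-! ### Signed permutation matrices. -/

section SignedPermutation

variable {n : ℕ} {P : Matrix (Fin n) (Fin n) ℝ} {σ : Equiv.Perm (Fin n)} {s : Fin n → ℝ}

theorem signedPermutation_mulVec (hP : ∀ i j, P i j = if i = σ j then s j else 0) (x : Fin n → ℝ)
    (i : Fin n) : (P *ᵥ x) (σ i) = s i * x i := by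
  simp [mulVec, dotProduct, hP]

theorem signedPermutation_conj (hP : ∀ i j, P i j = if i = σ j then s j else 0)
    (T : Matrix (Fin n) (Fin n) ℝ) (i j : Fin n) :
    (P * T * Pᵀ) (σ i) (σ j) = s i * s j * T i j := by
  simp only [mul_apply, transpose_apply, hP, σ.injective.eq_iff]
  simp
  ring

theorem signedPermutation_transpose_mul (hs : ∀ j, s j = 1 ∨ s j = -1)
    (hP : ∀ i j, P i j = if i = σ j then s j else 0) : Pᵀ * P = 1 := by
  ext i j
  simp only [mul_apply, transpose_apply, hP, one_apply]
  by_cases h : i = j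
  · subst h
    simp [sq_eq_one_of_sign (hs i)]
  · simp [h, Ne.symm h]

end SignedPermutation

/-! ### The main theorem. -/

theorem theorem5p1
    (F : BinaryFormat) (rd : ℝ → ℝ) (hrd : F.IsRoundToNearest rd)
    (n : ℕ) (A P : Matrix (Fin n) (Fin n) ℝ) (b : Fin n → ℝ) (α β : ℕ → ℝ)
    -- the data of the structured problem
    (hP : IsSignedPermutation P)
    (hα : ∀ j, j < n → F.IsFloat (α j))
    (hβ : ∀ j, j < n → F.IsFloat (β j) ∧ 0 < β j ∧ F.InRange (β j ^ 2))
    (hA : A = P * tridiag n α β * P.transpose)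
    (hb : b = β 0 • P.mulVec (firstUnitVec n))
    (hSPD : A.PosDef)
    (k : ℕ) (hk : 0 < k) (hkn : k ≤ n)
    -- neither overflow nor underflow in the numerical solution of the tridiagonal system
    (hsolve : LDLSolveInRange rd (lanczosAlpha rd A b) (lanczosBeta rd A b)
      (lanczosBeta rd A b 0) F k)
    (hκ : 5 * F.unitRoundoff * condNumber A < 1) :
    -- neither algorithm breaks down, and the quotient below is a genuine one
    (∀ j, j < k → lanczosBeta rd A b j ≠ 0) ∧
    (∀ j, j < k → ldlD rd (lanczosAlpha rd A b) (lanczosBeta rd A b) j ≠ 0) ∧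
    cgX A b 0 k ≠ 0 ∧
    computedX rd A b k = (lanczosV rd A b k).mulVec (computedY rd A b k) ∧
    ‖WithLp.toLp 2 (cgX A b 0 k - computedX rd A b k)‖ / ‖WithLp.toLp 2 (cgX A b 0 k)‖ ≤
      5 * F.unitRoundoff * condNumber A / (1 - 5 * F.unitRoundoff * condNumber A) := by
  obtain ⟨σ, s, hs, hPσ⟩ := hP
  have hPP := signedPermutation_transpose_mul hs hPσ
  have hAσ : ∀ i j, A (σ i) (σ j) = s i * s j * tridiag n α β i j := by
    rw [hA]
    exact signedPermutation_conj hPσ _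
  have hbσ : ∀ i, b (σ i) = if (i : ℕ) = 0 then s i * β 0 else 0 := by
    intro i
    rw [hb, Pi.smul_apply, signedPermutation_mulVec hPσ, firstUnitVec, smul_eq_mul]
    split_ifs <;> ring
  have hn : 0 < n := hk.trans_le hkn
  have hαL := fun j hj => lanczosAlpha_eq (j := j) hrd hα hβ hs hAσ hbσ hj
  have hβL := fun j hj => lanczosBeta_eq (j := j) hrd hα hβ hs hAσ hbσ hj
  have hβpos : ∀ j, j < n → 0 < lanczosBeta rd A b j := fun j hj => by
    rw [hβL j hj]
    exact (hβ j hj).2.1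
  have hmv := flMulVec_lanczosV hrd hα hβ hs hAσ hbσ hkn (y := computedY rd A b k)
    fun j => hsolve.ldlY_isFloat hrd j.2
  have hmv' := lanczosV_mulVec hrd hα hβ hs hAσ hbσ hkn (computedY rd A b k)
  have hT := tridiag_congr hαL hβL
  -- The data are rewritten in terms of the computed coefficients, the ones `hsolve` refers to; the
  -- two agree for indices below `n`.
  rw [← hT] at hA
  rw [← hβL 0 hn, ← mulVec_smul] at hb
  set T := tridiag n (lanczosAlpha rd A b) (lanczosBeta rd A b) with hTdef
  have hdot : ∀ x y : Fin n → ℝ, (P *ᵥ x) ⬝ᵥ (P *ᵥ y) = x ⬝ᵥ y := by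
    intro x y
    rw [dotProduct_mulVec, vecMul_mulVec, hPP, vecMul_one]
  have hnorm : ∀ x : Fin n → ℝ, ‖WithLp.toLp 2 (P *ᵥ x)‖ = ‖WithLp.toLp 2 x‖ := by
    intro x
    rw [← sq_eq_sq₀ (norm_nonneg _) (norm_nonneg _), ← dotProduct_self_eq_norm_sq,
      ← dotProduct_self_eq_norm_sq, hdot]
  have hform : ∀ x y : Fin n → ℝ, (P *ᵥ x) ⬝ᵥ (A *ᵥ (P *ᵥ y)) = x ⬝ᵥ (T *ᵥ y) := by
    intro x y
    rw [hA, mulVec_mulVec, Matrix.mul_assoc, hPP, Matrix.mul_one, ← mulVec_mulVec, hdot]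
  have hker : ∀ x : Fin n → ℝ, P *ᵥ x = 0 → x = 0 := by
    intro x h
    rw [← one_mulVec x, ← hPP, ← mulVec_mulVec, h, mulVec_zero]
  have hpos : ∀ x : Fin n → ℝ, x ≠ 0 → 0 < x ⬝ᵥ (T *ᵥ x) := by
    intro x hx
    rw [← hform]
    exact hSPD.dotProduct_mulVec_pos (mt (hker x) hx)
  obtain ⟨hD, herr⟩ := ldlSol_error hrd hk hkn hβpos hsolve hpos (norm_nonneg _) (norm_nonneg _)
    (fun x => by
      rw [← hdot x x, ← hform x x]
      exact hSPD.dotProduct_self_le _)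
    (fun x y => by
      rw [← hform, ← hnorm x, ← hnorm y]
      exact dotProduct_mulVec_le A _ _) hκ
  have hx0 := cgX_tridiag_ne_zero hk hkn hβpos hpos
  have hcg : cgX A b 0 k =
      P *ᵥ (cgState T (lanczosBeta rd A b 0 • firstUnitVec n) 0 k).x := by
    have := cgState_orthogonal (T := T) hPP (lanczosBeta rd A b 0 • firstUnitVec n) k
    rw [← hA, ← hb] at this
    rw [cgX, this]
  have hcomp : computedX rd A b k = P *ᵥ fun i : Fin n =>
      ldlSol rd (lanczosAlpha rd A b) (lanczosBeta rd A b) (lanczosBeta rd A b 0) k i := by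
    ext i
    obtain ⟨i, rfl⟩ := σ.surjective i
    rw [signedPermutation_mulVec hPσ, computedX, hmv]
    simp [ldlSol, computedY]
  set y : Fin n → ℝ := fun i : Fin n =>
    ldlSol rd (lanczosAlpha rd A b) (lanczosBeta rd A b) (lanczosBeta rd A b 0) k i
  set x := (cgState T (lanczosBeta rd A b 0 • firstUnitVec n) 0 k).x
  refine ⟨fun j hj => (hβpos j (hj.trans_le hkn)).ne', hD, ?_, ?_, ?_⟩
  · rw [hcg]
    exact mt (hker x) hx0
  · ext i
    obtain ⟨i, rfl⟩ := σ.surjective i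
    rw [computedX, hmv, hmv']
  · rw [hcg, hcomp, ← mulVec_sub, hnorm, hnorm]
    have hxpos : 0 < ‖WithLp.toLp 2 x‖ := norm_pos_iff.2 (by simpa using hx0)
    change _ ≤ 5 * F.unitRoundoff * condNumber A * _ at herr
    set ε := 5 * F.unitRoundoff * condNumber A
    have hε : 0 ≤ ε := by
      have := F.unitRoundoff_pos
      have : 0 ≤ condNumber A := mul_nonneg (norm_nonneg _) (norm_nonneg _)
      positivity
    have htri : ‖WithLp.toLp 2 y‖ ≤ ‖WithLp.toLp 2 x‖ + ‖WithLp.toLp 2 (x - y)‖ := by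
      have := norm_sub_le (WithLp.toLp 2 x) (WithLp.toLp 2 (x - y))
      rwa [WithLp.toLp_sub, sub_sub_cancel] at this
    rw [div_le_div_iff₀ hxpos (by linarith)]
    have := herr.trans (mul_le_mul_of_nonneg_left htri hε)
    linarith
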